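/- Let $F$ be a field of characteristic $2$, and for $\alpha\in F$, $\beta\in F^\times$ let $[\alpha,\beta)$ be the quaternion algebra $F\langle x,y : x^2+x=\alpha,\ y^2=\beta,\ xy+yx=y\rangle$. Let $A$ be a biquaternion division algebra over $F$, i.e. a division algebra isomorphic to $[\alpha,\beta)\otimes_F[\gamma,\delta)$ for some $\alpha,\gamma\in F$, $\beta,\delta\in F^\times$. A quadruple of generators of $A$ is a quadruple $(x,y,z,u)$ of elements generating $A$ as an $F$-algebra such that $$x^2+x\in F,\quad y^2\in F^\times,\quad z^2+z\in F,\quad u^2\in F^\times,$$ $$xy+yx=y,\quad zu+uz=u,\quad xz=zx,\quad xu=ux,\quad yz=zy,\quad yu=uy.$$ The order of the two pairs $(x,y)$ and $(z,u)$ is disregarded, i.e. $(x,y,z,u)$ and $(z,u,x,y)$ are identified. Consider the following steps from a quadruple of generators $(x,y,z,u)$ to another quadruple of generators: - $\Lambda_1$: at most one of the four generators is changed; - $\Omega_s$: $x$ and $z$ are preserved, and $y$ and $u$ are both multiplied (from the left) by $a+b(x+z)$ for some $a,b\in F$; - $\Omega_i$: $y$ and $u$ are preserved, and $ayu$ is added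 to both $x$ and $z$ for some $a\in F$; - $\Omega_c$: $y$ and $z$ are preserved, $x$ changes to $x+by(1+by)^{-1}z$ and $u$ changes to $(1+by)u$, for some $b\in F$. Then every two quadruples of generators of $A$ are connected by a chain of at most $45$ steps, of which at most $6$ are of type $\Omega_i$, $\Omega_s$ or $\Omega_c$ and all the rest are of type $\Lambda_1$. -/

import Mathlib

open scoped TensorProduct

/-- `A` is a biquaternion algebra over the field `F` (of characteristic `2`): a tensor product
`[α, β) ⊗ [γ, δ)` of two quaternion algebras. In characteristic `2` the symbol `[α, β)` is
Mathlib's `QuaternionAlgebra F α 1 β`, with basis `1, i, j, k = i * j` and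
`i * i = α + i`, `j * j = β`, `j * i = j - i * j`. -/
def IsBiquaternionAlgebra (F A : Type*) [Field F] [Ring A] [Algebra F A] : Prop :=
  ∃ α β γ δ : F, β ≠ 0 ∧ δ ≠ 0 ∧
    Nonempty (A ≃ₐ[F] QuaternionAlgebra F α 1 β ⊗[F] QuaternionAlgebra F γ 1 δ)

/-- A quadruple of (standard) generators `(x, y, z, u)` of the algebra `A` over `F`. -/
@[ext]
structure GenQuadruple (F A : Type*) [Field F] [Ring A] [Algebra F A] where
  x : A
  y : A
  z : A
  u : A
  x_artinSchreier : ∃ α : F, x ^ 2 + x = algebraMap F A α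
  y_squareCentral : ∃ β : F, β ≠ 0 ∧ y ^ 2 = algebraMap F A β
  z_artinSchreier : ∃ γ : F, z ^ 2 + z = algebraMap F A γ
  u_squareCentral : ∃ δ : F, δ ≠ 0 ∧ u ^ 2 = algebraMap F A δ
  xy : x * y + y * x = y
  xz : x * z = z * x
  xu : x * u = u * x
  yz : y * z = z * y
  yu : y * u = u * y
  zu : z * u + u * z = u
  generate : Algebra.adjoin F {x, y, z, u} = ⊤

namespace GenQuadruple

section Ring

variable {F A : Type*} [Field F] [Ring A] [Algebra F A]

/-- Interchange the two pairs: `(x, y, z, u) ↦ (z, u, x, y)`. -/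
def swap (q : GenQuadruple F A) : GenQuadruple F A where
  x := q.z
  y := q.u
  z := q.x
  u := q.y
  x_artinSchreier := q.z_artinSchreier
  y_squareCentral := q.u_squareCentral
  z_artinSchreier := q.x_artinSchreier
  u_squareCentral := q.y_squareCentral
  xy := q.zu
  xz := q.xz.symm
  xu := q.yz.symm
  yz := q.xu.symm
  yu := q.yu.symm
  zu := q.xy
  generate := by
    rw [← q.generate]
    congr 1
    ext a
    simp only [Set.mem_insert_iff, Set.mem_singleton_iff]
    tauto

theorem swap_swap (q : GenQuadruple F A) : q.swap.swap = q := rfl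

variable (F A) in
/-- The order of the two pairs is immaterial: `(x, y, z, u)` and `(z, u, x, y)` are identified. -/
def pairSetoid : Setoid (GenQuadruple F A) where
  r q q' := q' = q ∨ q' = q.swap
  iseqv :=
    { refl := fun _ => Or.inl rfl
      symm := by
        rintro q q' (h | h)
        · exact Or.inl h.symm
        · exact Or.inr (by rw [h, swap_swap])
      trans := by
        rintro q q' q'' (h | h) (h' | h')
        · exact Or.inl (by rw [h', h])
        · exact Or.inr (by rw [h', h])
        · exact Or.inr (by rw [h', h])
        · exact Or.inl (by rw [h', h, swap_swap]) }

variable (F A) in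
/-- Quadruples of generators, with `(x, y, z, u) = (z, u, x, y)`. -/
def Unordered : Type _ := Quotient (pairSetoid F A)

/-- The quadruple `q`, up to the order of its two pairs. -/
def toUnordered (q : GenQuadruple F A) : Unordered F A := Quotient.mk (pairSetoid F A) q

/-- `Λ₁`: at most one generator is changed. -/
def Lambda1 (q q' : GenQuadruple F A) : Prop :=
  (q'.y = q.y ∧ q'.z = q.z ∧ q'.u = q.u) ∨
  (q'.x = q.x ∧ q'.z = q.z ∧ q'.u = q.u) ∨
  (q'.x = q.x ∧ q'.y = q.y ∧ q'.u = q.u) ∨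
  (q'.x = q.x ∧ q'.y = q.y ∧ q'.z = q.z)

/-- `Ω_s`: `x` and `z` are preserved, and `y` and `u` are multiplied by `a + b (x + z)` for some
`a b : F`. (As `(x + z) y = y (x + z + 1)` and `(x + z) u = u (x + z + 1)`, multiplying from the
right instead only replaces `a` by `a + b`.) -/
def OmegaS (q q' : GenQuadruple F A) : Prop :=
  ∃ a b : F, q'.x = q.x ∧ q'.z = q.z ∧
    q'.y = (algebraMap F A a + b • (q.x + q.z)) * q.y ∧
    q'.u = (algebraMap F A a + b • (q.x + q.z)) * q.u

/-- `Ω_i`: `y` and `u` are preserved, and `a y u` is added to `x` and to `z` for some `a : F`. -/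
def OmegaI (q q' : GenQuadruple F A) : Prop :=
  ∃ a : F, q'.y = q.y ∧ q'.u = q.u ∧
    q'.x = q.x + a • (q.y * q.u) ∧ q'.z = q.z + a • (q.y * q.u)

/-- A relation `R` between quadruples, read on quadruples up to the order of the pairs. -/
def UpToOrder (R : GenQuadruple F A → GenQuadruple F A → Prop) (P P' : Unordered F A) : Prop :=
  ∃ q q' : GenQuadruple F A, q.toUnordered = P ∧ q'.toUnordered = P' ∧ R q q'

end Ring

section DivisionRing

variable {F A : Type*} [Field F] [DivisionRing A] [Algebra F A]

/-- `Ω_c`: `y` and `z` are preserved, `x` changes to `x + b y (1 + b y)⁻¹ z` and `u` changes to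
`(1 + b y) u`, for some `b : F`. -/
def OmegaC (q q' : GenQuadruple F A) : Prop :=
  ∃ b : F, q'.y = q.y ∧ q'.z = q.z ∧
    q'.x = q.x + b • q.y * (1 + b • q.y)⁻¹ * q.z ∧ q'.u = (1 + b • q.y) * q.u

/-- A step of type `Ω_i`, `Ω_s` or `Ω_c`. -/
def Omega (q q' : GenQuadruple F A) : Prop :=
  OmegaI q q' ∨ OmegaS q q' ∨ OmegaC q q'

/-- `P` and `P'` are connected by a chain of at most `N` steps, of which at most `k` are of type
`Ω_i`, `Ω_s` or `Ω_c` (those with index in `S`) and all the others are of type `Λ₁`. -/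
def ConnectedByChain (N k : ℕ) (P P' : Unordered F A) : Prop :=
  ∃ n ≤ N, ∃ c : ℕ → Unordered F A, c 0 = P ∧ c n = P' ∧
    ∃ S : Finset ℕ, S.card ≤ k ∧
      (∀ i < n, i ∈ S → UpToOrder Omega (c i) (c (i + 1))) ∧
      (∀ i < n, i ∉ S → UpToOrder Lambda1 (c i) (c (i + 1)))

end DivisionRing

end GenQuadruple

/-! Attach to a quadruple the tensor product `s` of the canonical involutions of its two quaternion
factors. Every `a + s a` lies in the span of `x + z` and V = F + Fy + Fxy + Fu + Fzu. Elements of V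
have scalar squares, so squaring is a quadratic form on V with polar form `v w + w v`.

Changing the involution. If `s'` belongs to another quadruple, an explicit Skolem–Noether argument
gives `s' a = g (s a) g⁻¹`, and `g` itself has the form `a + s a`. When `x + z` occurs in `g`,
rescaling and a change of generators inside the two factors turn `g` into `x + z`, and multiplying
`y` and `u` by it is a step Ω_s realizing the conjugation. When it does not occur, a detour through
a suitable `g₀` makes it occur for `g g₀⁻¹`, since otherwise `g₀` would be scalar. So two steps Ω_s
suffice (`exists_connected_of_involution`).

Fixing the involution. If both quadruples have involution `s`, then `y'` lies in V. After a
preliminary change, `y y' + y' y = e ≠ 0`, so `y` and `y'` generate a quaternion algebra. One Ω_i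
from each side reaches a quadruple having it as a factor (`exists_omegaI`), and quadruples with the
same factors are joined by Λ₁ steps (`connected_of_commute`).

The count is 18 + 15 = 33 steps with 2 + 2 = 4 of type Ω; Ω_c is never needed. -/

/-! ### Relations and the universal property. -/

section Relations

variable {F A : Type*} [Field F] [Ring A] [Algebra F A]

/-- The defining relations of `[α, β)` in characteristic `2`, in the form of rewriting rules. -/
structure QuaternionRel (α β : F) (x y : A) : Prop where
  ne_zero : β ≠ 0
  xx : x * x = x + α • 1
  yy : y * y = β • 1
  yx : y * x = x * y + y

/-- The defining relations of `[α, β) ⊗ [γ, δ)` in characteristic `2`. -/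
structure BiquaternionRel (α β γ δ : F) (x y z u : A) : Prop where
  left : QuaternionRel α β x y
  right : QuaternionRel γ δ z u
  zx : z * x = x * z
  ux : u * x = x * u
  zy : z * y = y * z
  uy : u * y = y * u

theorem QuaternionRel.rules {α β : F} {x y : A} (h : QuaternionRel α β x y) :
    (x * x = x + α • 1 ∧ y * y = β • 1 ∧ y * x = x * y + (1 : F) • y) ∧
    (∀ t, x * (x * t) = x * t + α • t) ∧ (∀ t, y * (y * t) = β • t) ∧
    (∀ t, y * (x * t) = x * (y * t) + (1 : F) • (y * t)) := by
  refine ⟨⟨h.xx, h.yy, by rw [h.yx, one_smul]⟩, fun t => ?_, fun t => ?_, fun t => ?_⟩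
  · rw [← mul_assoc, h.xx, add_mul, smul_one_mul]
  · rw [← mul_assoc, h.yy, smul_one_mul]
  · rw [← mul_assoc, h.yx, add_mul, mul_assoc, one_smul]

theorem commute_rules {a b : A} (h : b * a = a * b) :
    b * a = a * b ∧ ∀ t, b * (a * t) = a * (b * t) :=
  ⟨h, fun t => by rw [← mul_assoc, h, mul_assoc]⟩

/-- Rules which bring every product of `x`, `y`, `z`, `u` into the form of a combination of
monomials `x ^ i * y ^ j * z ^ k * u ^ l`, with exponents at most `1`. -/
theorem BiquaternionRel.rules {α β γ δ : F} {x y z u : A} (h : BiquaternionRel α β γ δ x y z u) :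
    (((x * x = x + α • 1 ∧ y * y = β • 1 ∧ y * x = x * y + (1 : F) • y) ∧
    (∀ t, x * (x * t) = x * t + α • t) ∧ (∀ t, y * (y * t) = β • t) ∧
    (∀ t, y * (x * t) = x * (y * t) + (1 : F) • (y * t))) ∧
    ((z * z = z + γ • 1 ∧ u * u = δ • 1 ∧ u * z = z * u + (1 : F) • u) ∧
    (∀ t, z * (z * t) = z * t + γ • t) ∧ (∀ t, u * (u * t) = δ • t) ∧
    (∀ t, u * (z * t) = z * (u * t) + (1 : F) • (u * t)))) ∧
    ((z * x = x * z ∧ ∀ t, z * (x * t) = x * (z * t)) ∧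
    (u * x = x * u ∧ ∀ t, u * (x * t) = x * (u * t)) ∧
    (z * y = y * z ∧ ∀ t, z * (y * t) = y * (z * t)) ∧
    (u * y = y * u ∧ ∀ t, u * (y * t) = y * (u * t))) :=
  ⟨⟨h.left.rules, h.right.rules⟩, commute_rules h.zx, commute_rules h.ux, commute_rules h.zy,
    commute_rules h.uy⟩

theorem BiquaternionRel.swap {α β γ δ : F} {x y z u : A} (h : BiquaternionRel α β γ δ x y z u) :
    BiquaternionRel γ δ α β z u x y :=
  ⟨h.right, h.left, h.zx.symm, h.zy.symm, h.ux.symm, h.uy.symm⟩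

theorem add_self_of_charTwo (F : Type*) [Field F] [CharP F 2] [Algebra F A] (a : A) : a + a = 0 := by
  have : (2 : F) = 0 := CharTwo.two_eq_zero
  rw [← two_smul F, this, zero_smul]

theorem neg_eq_self_of_charTwo (F : Type*) [Field F] [CharP F 2] [Algebra F A] (a : A) :
    -a = a :=
  neg_eq_of_add_eq_zero_left (add_self_of_charTwo F a)

theorem add_eq_zero_iff_of_charTwo (F : Type*) [Field F] [CharP F 2] [Algebra F A] {a b : A} :
    a + b = 0 ↔ a = b := by
  rw [add_eq_zero_iff_eq_neg, neg_eq_self_of_charTwo F]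

variable [CharP F 2]

/-- The basis of the quaternion subalgebra generated by `x` and `y`. -/
def QuaternionRel.basis {α β : F} {x y : A} (h : QuaternionRel α β x y) :
    QuaternionAlgebra.Basis A α 1 β where
  i := x
  j := y
  k := x * y
  i_mul_i := by rw [h.xx, one_smul, add_comm]
  j_mul_j := h.yy
  i_mul_j := rfl
  j_mul_i := by
    rw [h.yx, one_smul, sub_eq_add_neg, neg_eq_self_of_charTwo F, add_comm]

theorem QuaternionRel.liftHom_basis {α β : F} {x y : A} (h : QuaternionRel α β x y)
    (p : QuaternionAlgebra F α 1 β) :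
    h.basis.liftHom p = p.re • 1 + p.imI • x + p.imJ • y + p.imK • (x * y) := by
  simp [QuaternionAlgebra.Basis.lift, QuaternionRel.basis, Algebra.algebraMap_eq_smul_one]

theorem BiquaternionRel.commute_basis {α β γ δ : F} {x y z u : A}
    (h : BiquaternionRel α β γ δ x y z u) (p : QuaternionAlgebra F α 1 β)
    (r : QuaternionAlgebra F γ 1 δ) :
    Commute (h.left.basis.liftHom p) (h.right.basis.liftHom r) := by
  have hx : Commute x z := h.zx.symm
  have hxu : Commute x u := h.ux.symm
  have hy : Commute y z := h.zy.symm
  have hyu : Commute y u := h.uy.symm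
  rw [QuaternionRel.liftHom_basis, QuaternionRel.liftHom_basis]
  have key : ∀ w : A, Commute w z → Commute w u →
      Commute w (r.re • 1 + r.imI • z + r.imJ • u + r.imK • (z * u)) := fun w h1 h2 =>
    ((((Commute.one_right _).smul_right _).add_right (h1.smul_right _)).add_right
      (h2.smul_right _)).add_right ((h1.mul_right h2).smul_right _)
  exact (((((Commute.one_left _).smul_left _).add_left ((key x hx hxu).smul_left _)).add_left
    ((key y hy hyu).smul_left _)).add_left
      ((key _ (hx.mul_left hy) (hxu.mul_left hyu)).smul_left _))

/-- The homomorphism from the tensor product of quaternion algebras given by a tuple which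
satisfies the relations. -/
noncomputable def BiquaternionRel.hom {α β γ δ : F} {x y z u : A}
    (h : BiquaternionRel α β γ δ x y z u) :
    QuaternionAlgebra F α 1 β ⊗[F] QuaternionAlgebra F γ 1 δ →ₐ[F] A :=
  Algebra.TensorProduct.lift h.left.basis.liftHom h.right.basis.liftHom h.commute_basis

theorem BiquaternionRel.hom_tmul {α β γ δ : F} {x y z u : A}
    (h : BiquaternionRel α β γ δ x y z u) (p : QuaternionAlgebra F α 1 β)
    (r : QuaternionAlgebra F γ 1 δ) :
    h.hom (p ⊗ₜ r) = (p.re • 1 + p.imI • x + p.imJ • y + p.imK • (x * y)) *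
      (r.re • 1 + r.imI • z + r.imJ • u + r.imK • (z * u)) := by
  rw [hom, Algebra.TensorProduct.lift_tmul, QuaternionRel.liftHom_basis,
    QuaternionRel.liftHom_basis]

end Relations

/-! ### Linear independence in a division algebra. -/

section Independence

variable {F A : Type*} [Field F] [DivisionRing A] [Algebra F A]

theorem QuaternionRel.y_ne_zero {α β : F} {x y : A} (h : QuaternionRel α β x y) : y ≠ 0 := by
  rintro rfl
  have := h.yy
  rw [mul_zero, eq_comm, smul_eq_zero] at this
  exact this.elim h.ne_zero one_ne_zero

variable [CharP F 2]

/-- The elements `1, x, y, x y` are independent over their centralizer. -/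
theorem QuaternionRel.independent {α β : F} {x y : A} (h : QuaternionRel α β x y)
    {r₀ r₁ r₂ r₃ : A} (h₀ : x * r₀ = r₀ * x) (h₁ : x * r₁ = r₁ * x) (h₂ : x * r₂ = r₂ * x)
    (h₃ : x * r₃ = r₃ * x) (h₀' : y * r₀ = r₀ * y) (h₁' : y * r₁ = r₁ * y)
    (h₂' : y * r₂ = r₂ * y) (h₃' : y * r₃ = r₃ * y)
    (h0 : r₀ + r₁ * x + r₂ * y + r₃ * (x * y) = 0) : r₀ = 0 ∧ r₁ = 0 ∧ r₂ = 0 ∧ r₃ = 0 := by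
  have hy := h.y_ne_zero
  -- Commutators with `x` and then `y` isolate the coefficients one at a time; `y` is invertible.
  have e1 : (r₂ + r₃ * x) * y = 0 := by
    have : x * (r₀ + r₁ * x + r₂ * y + r₃ * (x * y)) + (r₀ + r₁ * x + r₂ * y + r₃ * (x * y)) * x
        = (r₂ + r₃ * x) * y := by
      simp only [mul_add, add_mul, mul_assoc, h.rules, (commute_rules h₀), (commute_rules h₁),
        (commute_rules h₂), (commute_rules h₃), mul_smul_comm, mul_one]
      match_scalars <;> grind
    rw [← this, h0, mul_zero, zero_mul, add_zero]
  have e2 := (mul_eq_zero.1 e1).resolve_right hy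
  have e3 : r₃ * y = 0 := by
    have : y * (r₂ + r₃ * x) + (r₂ + r₃ * x) * y = r₃ * y := by
      simp only [mul_add, add_mul, mul_assoc, h.rules, (commute_rules h₂'), (commute_rules h₃'),
        mul_smul_comm]
      match_scalars <;> grind
    rw [← this, e2, mul_zero, zero_mul, add_zero]
  have r3 := (mul_eq_zero.1 e3).resolve_right hy
  rw [r3, zero_mul, add_zero] at e2
  rw [r3, e2, zero_mul, zero_mul, add_zero, add_zero] at h0
  have e4 : r₁ * y = 0 := by
    have : y * (r₀ + r₁ * x) + (r₀ + r₁ * x) * y = r₁ * y := by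
      simp only [mul_add, add_mul, mul_assoc, h.rules, (commute_rules h₀'), (commute_rules h₁'),
        mul_smul_comm]
      match_scalars <;> grind
    rw [← this, h0, mul_zero, zero_mul, add_zero]
  have r1 := (mul_eq_zero.1 e4).resolve_right hy
  rw [r1, zero_mul, add_zero] at h0
  exact ⟨h0, r1, e2, r3⟩

theorem QuaternionRel.independent_smul {α β : F} {x y : A} (h : QuaternionRel α β x y)
    {c₀ c₁ c₂ c₃ : F} (h0 : c₀ • (1 : A) + c₁ • x + c₂ • y + c₃ • (x * y) = 0) :
    c₀ = 0 ∧ c₁ = 0 ∧ c₂ = 0 ∧ c₃ = 0 := by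
  have key := h.independent (r₀ := c₀ • 1) (r₁ := c₁ • 1) (r₂ := c₂ • 1) (r₃ := c₃ • 1)
    (by simp) (by simp) (by simp) (by simp) (by simp) (by simp) (by simp) (by simp)
    (by simpa using h0)
  simpa using key

end Independence

/-! ### Tuples satisfying the relations generate; centralizers. -/

section Generation

theorem IsBiquaternionAlgebra.finrank_eq {F A : Type*} [Field F] [Ring A] [Algebra F A]
    (hA : IsBiquaternionAlgebra F A) :
    Module.finrank F A = 16 := by
  obtain ⟨α, β, γ, δ, -, -, ⟨e⟩⟩ := hA
  rw [e.toLinearEquiv.finrank_eq, Module.finrank_tensorProduct,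
    QuaternionAlgebra.finrank_eq_four, QuaternionAlgebra.finrank_eq_four]

variable {F A : Type*} [Field F] [CharP F 2] [DivisionRing A] [Algebra F A]
variable {α β γ δ : F} {x y z u : A}

theorem BiquaternionRel.commute_right_basis (h : BiquaternionRel α β γ δ x y z u)
    (r : QuaternionAlgebra F γ 1 δ) :
    x * h.right.basis.liftHom r = h.right.basis.liftHom r * x ∧
      y * h.right.basis.liftHom r = h.right.basis.liftHom r * y := by
  have h1 := h.commute_basis ⟨0, 1, 0, 0⟩ r
  have h2 := h.commute_basis ⟨0, 0, 1, 0⟩ r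
  simp only [h.left.liftHom_basis, zero_smul, one_smul, zero_add, add_zero] at h1 h2
  exact ⟨h1, h2⟩

theorem BiquaternionRel.exists_hom_eq (h : BiquaternionRel α β γ δ x y z u)
    (t : QuaternionAlgebra F α 1 β ⊗[F] QuaternionAlgebra F γ 1 δ) :
    ∃ r₀ r₁ r₂ r₃ : QuaternionAlgebra F γ 1 δ,
      t = 1 ⊗ₜ r₀ + ⟨0, 1, 0, 0⟩ ⊗ₜ r₁ + ⟨0, 0, 1, 0⟩ ⊗ₜ r₂ + ⟨0, 0, 0, 1⟩ ⊗ₜ r₃ ∧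
      h.hom t = h.right.basis.liftHom r₀ + h.right.basis.liftHom r₁ * x +
        h.right.basis.liftHom r₂ * y + h.right.basis.liftHom r₃ * (x * y) := by
  have key : ∃ r₀ r₁ r₂ r₃ : QuaternionAlgebra F γ 1 δ,
      t = 1 ⊗ₜ r₀ + ⟨0, 1, 0, 0⟩ ⊗ₜ r₁ + ⟨0, 0, 1, 0⟩ ⊗ₜ r₂ + ⟨0, 0, 0, 1⟩ ⊗ₜ r₃ := by
    induction t with
    | zero => exact ⟨0, 0, 0, 0, by simp⟩
    | tmul p r =>
      refine ⟨p.re • r, p.imI • r, p.imJ • r, p.imK • r, ?_⟩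
      simp only [← TensorProduct.smul_tmul, ← TensorProduct.add_tmul]
      congr 1
      ext <;> simp
    | add s t hs ht =>
      obtain ⟨a₀, a₁, a₂, a₃, rfl⟩ := hs
      obtain ⟨b₀, b₁, b₂, b₃, rfl⟩ := ht
      refine ⟨a₀ + b₀, a₁ + b₁, a₂ + b₂, a₃ + b₃, ?_⟩
      simp only [TensorProduct.tmul_add]
      abel
  obtain ⟨r₀, r₁, r₂, r₃, rfl⟩ := key
  refine ⟨r₀, r₁, r₂, r₃, rfl, ?_⟩
  have h1 := fun r => (h.commute_right_basis r).1
  have h2 := fun r => (h.commute_right_basis r).2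
  simp only [map_add, BiquaternionRel.hom, Algebra.TensorProduct.lift_tmul,
    h.left.liftHom_basis, zero_smul, one_smul, zero_add, add_zero, ← mul_assoc, h1, h2]
  simp only [mul_assoc, h2]
  simp only [← mul_assoc, h1]
  simp

/-- Independence over the centralizer, then independence of `1, z, u, z u` over F. With dimension 16
on both sides this yields bijectivity. -/
theorem BiquaternionRel.hom_injective (h : BiquaternionRel α β γ δ x y z u) :
    Function.Injective h.hom := by
  rw [injective_iff_map_eq_zero]
  intro t ht
  obtain ⟨r₀, r₁, r₂, r₃, rfl, e⟩ := h.exists_hom_eq t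
  rw [ht] at e
  have h1 := fun r => (h.commute_right_basis r).1
  have h2 := fun r => (h.commute_right_basis r).2
  obtain ⟨e0, e1, e2, e3⟩ := h.left.independent (h1 _) (h1 _) (h1 _) (h1 _) (h2 _) (h2 _) (h2 _)
    (h2 _) e.symm
  have inj : ∀ r, h.right.basis.liftHom r = 0 → r = 0 := by
    intro r hr
    rw [h.right.liftHom_basis] at hr
    obtain ⟨c0, c1, c2, c3⟩ := h.right.independent_smul hr
    ext <;> assumption
  rw [inj _ e0, inj _ e1, inj _ e2, inj _ e3]
  simp

theorem BiquaternionRel.hom_bijective (h : BiquaternionRel α β γ δ x y z u)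
    (hd : Module.finrank F A = 16) : Function.Bijective h.hom := by
  have : FiniteDimensional F A := FiniteDimensional.of_finrank_pos (by omega)
  refine ⟨h.hom_injective, ?_⟩
  refine (LinearMap.injective_iff_surjective_of_finrank_eq_finrank
    (f := h.hom.toLinearMap) ?_).1 h.hom_injective
  rw [hd, Module.finrank_tensorProduct, QuaternionAlgebra.finrank_eq_four,
    QuaternionAlgebra.finrank_eq_four]

theorem BiquaternionRel.exists_eq (h : BiquaternionRel α β γ δ x y z u)
    (hd : Module.finrank F A = 16) (a : A) :
    ∃ r₀ r₁ r₂ r₃ : QuaternionAlgebra F γ 1 δ, a = h.right.basis.liftHom r₀ +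
      h.right.basis.liftHom r₁ * x + h.right.basis.liftHom r₂ * y +
      h.right.basis.liftHom r₃ * (x * y) := by
  obtain ⟨t, rfl⟩ := (h.hom_bijective hd).2 a
  obtain ⟨r₀, r₁, r₂, r₃, -, e⟩ := h.exists_hom_eq t
  exact ⟨r₀, r₁, r₂, r₃, e⟩

theorem BiquaternionRel.adjoin_eq_top (h : BiquaternionRel α β γ δ x y z u)
    (hd : Module.finrank F A = 16) : Algebra.adjoin F {x, y, z, u} = ⊤ := by
  rw [eq_top_iff]
  rintro a -
  obtain ⟨r₀, r₁, r₂, r₃, rfl⟩ := h.exists_eq hd a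
  have hx : x ∈ Algebra.adjoin F {x, y, z, u} := Algebra.subset_adjoin (by simp)
  have hy : y ∈ Algebra.adjoin F {x, y, z, u} := Algebra.subset_adjoin (by simp)
  have hz : z ∈ Algebra.adjoin F {x, y, z, u} := Algebra.subset_adjoin (by simp)
  have hu : u ∈ Algebra.adjoin F {x, y, z, u} := Algebra.subset_adjoin (by simp)
  have key : ∀ r, h.right.basis.liftHom r ∈ Algebra.adjoin F {x, y, z, u} := fun r => by
    rw [h.right.liftHom_basis]
    exact add_mem (add_mem (add_mem (Subalgebra.smul_mem _ (one_mem _) _)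
      (Subalgebra.smul_mem _ hz _)) (Subalgebra.smul_mem _ hu _))
      (Subalgebra.smul_mem _ (mul_mem hz hu) _)
  exact add_mem (add_mem (add_mem (key _) (mul_mem (key _) hx)) (mul_mem (key _) hy))
    (mul_mem (key _) (mul_mem hx hy))

/-- The centralizer of one quaternion factor is the other one. -/
theorem BiquaternionRel.exists_of_commute (h : BiquaternionRel α β γ δ x y z u)
    (hd : Module.finrank F A = 16) {a : A} (hx : x * a = a * x) (hy : y * a = a * y) :
    ∃ c₀ c₁ c₂ c₃ : F, a = c₀ • (1 : A) + c₁ • z + c₂ • u + c₃ • (z * u) := by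
  obtain ⟨r₀, r₁, r₂, r₃, e⟩ := h.exists_eq hd a
  have h1 := fun r => (h.commute_right_basis r).1
  have h2 := fun r => (h.commute_right_basis r).2
  have e' : (h.right.basis.liftHom r₀ + -a) + h.right.basis.liftHom r₁ * x +
      h.right.basis.liftHom r₂ * y + h.right.basis.liftHom r₃ * (x * y) = 0 := by
    rw [← sub_eq_zero.2 e.symm]
    abel
  have e0 := (h.left.independent (by rw [mul_add, add_mul, h1]; simp [hx]) (h1 _) (h1 _) (h1 _)
    (by rw [mul_add, add_mul, h2]; simp [hy]) (h2 _) (h2 _) (h2 _) e').1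
  refine ⟨r₀.re, r₀.imI, r₀.imJ, r₀.imK, ?_⟩
  rw [← h.right.liftHom_basis, ← sub_eq_zero, ← neg_eq_zero, ← e0]
  abel

theorem BiquaternionRel.exists_of_central (h : BiquaternionRel α β γ δ x y z u)
    (hd : Module.finrank F A = 16) {a : A} (hx : x * a = a * x) (hy : y * a = a * y)
    (hz : z * a = a * z) (hu : u * a = a * u) : ∃ c : F, a = c • (1 : A) := by
  obtain ⟨c₀, c₁, c₂, c₃, rfl⟩ := h.exists_of_commute hd hx hy
  have e1 : c₂ • u + c₃ • (z * u) = 0 := by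
    rw [← (add_eq_zero_iff_of_charTwo F).2 hz]
    simp only [mul_add, add_mul, mul_assoc, h.rules, mul_smul_comm, smul_mul_assoc, mul_one,
      one_mul, smul_add]
    match_scalars <;> grind
  obtain ⟨-, -, rfl, rfl⟩ := h.right.independent_smul (c₀ := 0) (c₁ := 0) (by simpa using e1)
  have e2 : c₁ • u = 0 := by
    rw [← (add_eq_zero_iff_of_charTwo F).2 hu]
    simp only [mul_add, add_mul, mul_assoc, h.rules, mul_smul_comm, smul_mul_assoc, mul_one,
      one_mul, smul_add]
    match_scalars <;> grind
  rw [smul_eq_zero] at e2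
  obtain rfl := e2.resolve_right h.right.y_ne_zero
  exact ⟨c₀, by simp⟩

/-- Elements which satisfy the relations of a generating tuple are the images of that tuple under
a homomorphism. -/
theorem BiquaternionRel.exists_algHom {B : Type*} [Ring B] [Algebra F B] {X Y Z U : B}
    (h : BiquaternionRel α β γ δ x y z u) (hd : Module.finrank F A = 16)
    (H : BiquaternionRel α β γ δ X Y Z U) :
    ∃ f : A →ₐ[F] B, f x = X ∧ f y = Y ∧ f z = Z ∧ f u = U := by
  let e := AlgEquiv.ofBijective h.hom (h.hom_bijective hd)
  have key : ∀ t, (H.hom.comp (e.symm : A →ₐ[F] _)) (h.hom t) = H.hom t := fun t => by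
    change H.hom (e.symm (e t)) = _
    rw [e.symm_apply_apply]
  refine ⟨H.hom.comp (e.symm : A →ₐ[F] _), ?_, ?_, ?_, ?_⟩
  · have := key ((⟨0, 1, 0, 0⟩ : QuaternionAlgebra F α 1 β) ⊗ₜ 1)
    simpa [BiquaternionRel.hom_tmul] using this
  · have := key ((⟨0, 0, 1, 0⟩ : QuaternionAlgebra F α 1 β) ⊗ₜ 1)
    simpa [BiquaternionRel.hom_tmul] using this
  · have := key (1 ⊗ₜ (⟨0, 1, 0, 0⟩ : QuaternionAlgebra F γ 1 δ))
    simpa [BiquaternionRel.hom_tmul] using this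
  · have := key (1 ⊗ₜ (⟨0, 0, 1, 0⟩ : QuaternionAlgebra F γ 1 δ))
    simpa [BiquaternionRel.hom_tmul] using this

/-- The quadruple of generators given by elements which satisfy the relations. -/
def BiquaternionRel.toQuadruple (h : BiquaternionRel α β γ δ x y z u)
    (hd : Module.finrank F A = 16) : GenQuadruple F A where
  x := x
  y := y
  z := z
  u := u
  x_artinSchreier := ⟨α, by
    rw [sq, h.left.xx, Algebra.algebraMap_eq_smul_one, add_right_comm,
      add_self_of_charTwo F, zero_add]⟩
  y_squareCentral := ⟨β, h.left.ne_zero, by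
    rw [sq, h.left.yy, Algebra.algebraMap_eq_smul_one]⟩
  z_artinSchreier := ⟨γ, by
    rw [sq, h.right.xx, Algebra.algebraMap_eq_smul_one, add_right_comm,
      add_self_of_charTwo F, zero_add]⟩
  u_squareCentral := ⟨δ, h.right.ne_zero, by
    rw [sq, h.right.yy, Algebra.algebraMap_eq_smul_one]⟩
  xy := by
    rw [h.left.yx, ← add_assoc, add_self_of_charTwo F, zero_add]
  xz := h.zx.symm
  xu := h.ux.symm
  yz := h.zy.symm
  yu := h.uy.symm
  zu := by
    rw [h.right.yx, ← add_assoc, add_self_of_charTwo F, zero_add]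
  generate := h.adjoin_eq_top hd

theorem GenQuadruple.exists_rel (q : GenQuadruple F A) :
    ∃ α β γ δ : F, BiquaternionRel α β γ δ q.x q.y q.z q.u := by
  obtain ⟨α, hα⟩ := q.x_artinSchreier
  obtain ⟨β, hβ, hy⟩ := q.y_squareCentral
  obtain ⟨γ, hγ⟩ := q.z_artinSchreier
  obtain ⟨δ, hδ, hu⟩ := q.u_squareCentral
  rw [Algebra.algebraMap_eq_smul_one, sq] at hα hy hγ hu
  have key : ∀ a b c : A, a + b = c → a = b + c := fun a b c h => by
    rw [← h, add_left_comm, add_self_of_charTwo F, add_zero]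
  exact ⟨α, β, γ, δ, ⟨hβ, key _ _ _ hα, hy, key _ _ _ (by rw [add_comm]; exact q.xy)⟩,
    ⟨hδ, key _ _ _ hγ, hu, key _ _ _ (by rw [add_comm]; exact q.zu)⟩,
    q.xz.symm, q.xu.symm, q.yz.symm, q.yu.symm⟩

end Generation

/-! ### Concatenation of chains. -/

namespace GenQuadruple

section Chains

variable {F A : Type*} [Field F] [DivisionRing A] [Algebra F A]

theorem toUnordered_swap (q : GenQuadruple F A) : q.swap.toUnordered = q.toUnordered :=
  Quotient.sound (Or.inr (q.swap_swap).symm)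

theorem ConnectedByChain.mono {N k N' k' : ℕ} {P P' : Unordered F A}
    (h : ConnectedByChain N k P P') (hN : N ≤ N') (hk : k ≤ k') : ConnectedByChain N' k' P P' := by
  obtain ⟨n, hn, c, h0, h1, S, hS, hO, hL⟩ := h
  exact ⟨n, hn.trans hN, c, h0, h1, S, hS.trans hk, hO, hL⟩

theorem ConnectedByChain.trans {N k N' k' : ℕ} {P P' P'' : Unordered F A}
    (h : ConnectedByChain N k P P') (h' : ConnectedByChain N' k' P' P'') :
    ConnectedByChain (N + N') (k + k') P P'' := by
  obtain ⟨n, hn, c, h0, h1, S, hS, hO, hL⟩ := h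
  obtain ⟨n', hn', c', h0', h1', S', hS', hO', hL'⟩ := h'
  have hlow : ∀ i ≤ n, (if i ≤ n then c i else c' (i - n)) = c i := fun i hi => if_pos hi
  have hhigh : ∀ j, (if n + j ≤ n then c (n + j) else c' (n + j - n)) = c' j := by
    intro j
    by_cases hj : j = 0
    · subst hj
      simp [h0', h1]
    · rw [if_neg (by omega), Nat.add_sub_cancel_left]
  -- `S` may contain indices beyond the first chain; these are discarded so that they do not mark
  -- steps of the second.
  refine ⟨n + n', by omega, fun i => if i ≤ n then c i else c' (i - n), ?_, ?_,
    (S.filter (· < n)) ∪ S'.map (addLeftEmbedding n), ?_, ?_, ?_⟩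
  · simp [h0]
  · simp only [hhigh, h1']
  · refine (Finset.card_union_le _ _).trans (add_le_add ?_ ?_)
    · exact (Finset.card_filter_le _ _).trans hS
    · rw [Finset.card_map]
      exact hS'
  all_goals
    intro i hi hiS
    simp only [Finset.mem_union, Finset.mem_filter, Finset.mem_map, addLeftEmbedding_apply] at hiS
    by_cases hin : i < n
    · simp only [hlow i hin.le, hlow (i + 1) hin]
      first
      | refine hO i hin ?_
        rcases hiS with h | ⟨j, -, hj⟩
        · exact h.1
        · omega
      | exact hL i hin fun h => hiS (Or.inl ⟨h, hin⟩)
    · obtain ⟨j, rfl⟩ := Nat.exists_eq_add_of_le (not_lt.1 hin)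
      simp only [add_assoc, hhigh]
      first
      | refine hO' j (by omega) ?_
        rcases hiS with h | ⟨l, hl, hj⟩
        · omega
        · obtain rfl : l = j := by omega
          exact hl
      | exact hL' j (by omega) fun h => hiS (Or.inr ⟨j, h, rfl⟩)

theorem Lambda1.connected {q q' : GenQuadruple F A} (h : Lambda1 q q') :
    ConnectedByChain 1 0 q.toUnordered q'.toUnordered :=
  ⟨1, le_rfl, fun i => if i = 0 then q.toUnordered else q'.toUnordered, by simp, by simp, ∅,
    by simp, by simp, fun i hi _ => by
      obtain rfl : i = 0 := by omega
      exact ⟨q, q', by simp, by simp, h⟩⟩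

theorem Omega.connected {q q' : GenQuadruple F A} (h : Omega q q') :
    ConnectedByChain 1 1 q.toUnordered q'.toUnordered :=
  ⟨1, le_rfl, fun i => if i = 0 then q.toUnordered else q'.toUnordered, by simp, by simp, {0},
    by simp, fun i hi _ => by
      obtain rfl : i = 0 := by omega
      exact ⟨q, q', by simp, by simp, h⟩, fun i hi h => by
      exact absurd (by omega : i = 0) (by simpa using h)⟩

end Chains

end GenQuadruple

/-! ### Λ₁ chains between quadruples with the same factors. -/

section QuaternionChains

/-- Two non-commuting square-central elements with scalar commutator share the Artin–Schreier
partner `e⁻¹ y y'`; it is the pivot of all chains below. -/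
theorem QuaternionRel.of_commutator {F A : Type*} [Field F] [CharP F 2] [Ring A] [Algebra F A]
    {β β' e : F} {y y' : A} (hβ : β ≠ 0) (hβ' : β' ≠ 0) (he : e ≠ 0) (hy : y * y = β • 1)
    (hy' : y' * y' = β' • 1) (h : y * y' + y' * y = e • 1) :
    QuaternionRel (e⁻¹ * e⁻¹ * β * β') β (e⁻¹ • (y * y')) y ∧
      QuaternionRel (e⁻¹ * e⁻¹ * β * β') β' (e⁻¹ • (y * y')) y' := by
  have hyy : y' * y = y * y' + e • 1 := by
    rw [← h, ← add_assoc, add_self_of_charTwo F, zero_add]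
  have r1 : ∀ t, y * (y * t) = β • t := fun t => by rw [← mul_assoc, hy, smul_one_mul]
  have r3 : ∀ t, y' * (y * t) = y * (y' * t) + e • t := fun t => by
    rw [← mul_assoc, hyy, add_mul, mul_assoc, smul_one_mul]
  refine ⟨⟨hβ, ?_, hy, ?_⟩, ⟨hβ', ?_, hy', ?_⟩⟩ <;>
  simp only [mul_add, mul_assoc, smul_mul_assoc, mul_smul_comm, hy, hy', hyy, r1, r3, mul_one,
    smul_add] <;>
  match_scalars <;> grind

variable {F A : Type*} [Field F] [CharP F 2] [DivisionRing A] [Algebra F A]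

open GenQuadruple

theorem QuaternionRel.mul_right {α β : F} {x y : A} (h : QuaternionRel α β x y) :
    QuaternionRel α (α * β) x (x * y) := by
  refine ⟨mul_ne_zero ?_ h.ne_zero, h.xx, ?_, ?_⟩
  -- For α = 0 the product `x (x + 1)` would vanish, making `x` a scalar.
  · rintro rfl
    have h1 : x * (x + 1) = 0 := by
      rw [mul_add, h.xx, mul_one, zero_smul, add_zero, add_self_of_charTwo F]
    rcases mul_eq_zero.1 h1 with h2 | h2
    · have := h.independent_smul (c₀ := 0) (c₁ := 1) (c₂ := 0) (c₃ := 0) (by simpa using h2)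
      simp at this
    · have := h.independent_smul (c₀ := 1) (c₁ := 1) (c₂ := 0) (c₃ := 0)
        (by simpa [add_comm] using h2)
      simp at this
  all_goals
    simp only [mul_add, mul_assoc, mul_smul_comm, h.rules, mul_one]
    match_scalars <;> grind

theorem BiquaternionRel.connected_of_commutator {α β γ δ α' β' e : F} {x y z u x' y' : A}
    (hd : Module.finrank F A = 16) (h : BiquaternionRel α β γ δ x y z u)
    (h' : BiquaternionRel α' β' γ δ x' y' z u) (he : e ≠ 0) (hyy : y * y' + y' * y = e • 1) :
    ConnectedByChain 3 0 (h.toQuadruple hd).toUnordered (h'.toQuadruple hd).toUnordered := by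
  obtain ⟨h1, h2⟩ := QuaternionRel.of_commutator h.left.ne_zero h'.left.ne_zero he h.left.yy
    h'.left.yy hyy
  have hz : z * (e⁻¹ • (y * y')) = (e⁻¹ • (y * y')) * z := by
    rw [mul_smul_comm, smul_mul_assoc, ← mul_assoc, h.zy, mul_assoc, h'.zy, mul_assoc]
  have hu : u * (e⁻¹ • (y * y')) = (e⁻¹ • (y * y')) * u := by
    rw [mul_smul_comm, smul_mul_assoc, ← mul_assoc, h.uy, mul_assoc, h'.uy, mul_assoc]
  let m₁ : BiquaternionRel _ _ γ δ _ _ z u := ⟨h1, h.right, hz, hu, h.zy, h.uy⟩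
  let m₂ : BiquaternionRel _ _ γ δ _ _ z u := ⟨h2, h.right, hz, hu, h'.zy, h'.uy⟩
  have s1 : Lambda1 (h.toQuadruple hd) (m₁.toQuadruple hd) := Or.inl ⟨rfl, rfl, rfl⟩
  have s2 : Lambda1 (m₁.toQuadruple hd) (m₂.toQuadruple hd) := Or.inr (Or.inl ⟨rfl, rfl, rfl⟩)
  have s3 : Lambda1 (m₂.toQuadruple hd) (h'.toQuadruple hd) := Or.inl ⟨rfl, rfl, rfl⟩
  exact (s1.connected.trans s2.connected).trans s3.connected

theorem QuaternionRel.sq_add {α β : F} {x y : A} (h : QuaternionRel α β x y) (a b c d : F) :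
    (a • 1 + b • x + c • y + d • (x * y)) * (a • 1 + b • x + c • y + d • (x * y)) =
      b • (a • 1 + b • x + c • y + d • (x * y)) +
        (a * a + a * b + b * b * α + β * (c * c + c * d + d * d * α)) • (1 : A) := by
  simp only [mul_add, add_mul, mul_assoc, smul_mul_assoc, mul_smul_comm, h.rules, one_mul,
    mul_one, smul_add]
  match_scalars <;> grind

/-- The polar values of `y'` with `y` and `x y` are `c₃ β` and `c₂ β`. They cannot both vanish, so
the common partner is available at once or after replacing `y` by `x y`. -/
theorem GenQuadruple.connected_of_right_eq (hd : Module.finrank F A = 16)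
    (q q' : GenQuadruple F A) (hz : q'.z = q.z) (hu : q'.u = q.u) :
    ConnectedByChain 4 0 q.toUnordered q'.toUnordered := by
  obtain ⟨α, β, γ, δ, h⟩ := q.exists_rel
  obtain ⟨α', β', γ', δ', h'⟩ := q'.exists_rel
  have h'' : BiquaternionRel α' β' γ δ q'.x q'.y q.z q.u :=
    ⟨h'.left, h.right, hz ▸ h'.zx, hu ▸ h'.ux, hz ▸ h'.zy, hu ▸ h'.uy⟩
  have hq' : h''.toQuadruple hd = q' := GenQuadruple.ext rfl rfl hz.symm hu.symm
  obtain ⟨c₀, c₁, c₂, c₃, e⟩ := h.swap.exists_of_commute hd h''.zy h''.uy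
  -- The coefficient of `x` in the scalar `y' ^ 2` is `c₁ ^ 2`.
  have hc₁ : c₁ = 0 := by
    have e1 := h'.left.yy
    rw [e, h.left.sq_add, ← (add_eq_zero_iff_of_charTwo F)] at e1
    have := h.left.independent_smul (c₀ := c₁ * c₀ +
      (c₀ * c₀ + c₀ * c₁ + c₁ * c₁ * α + β * (c₂ * c₂ + c₂ * c₃ + c₃ * c₃ * α)) + β')
      (c₁ := c₁ * c₁) (c₂ := c₁ * c₂) (c₃ := c₁ * c₃) (by rw [← e1]; module)
    simpa using this.2.1
  subst hc₁
  rw [zero_smul, add_zero] at e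
  have f1 : q.y * q'.y + q'.y * q.y = (c₃ * β) • (1 : A) := by
    rw [e]
    simp only [mul_add, add_mul, mul_assoc, smul_mul_assoc, mul_smul_comm, h.rules, one_mul,
      mul_one, smul_add]
    match_scalars <;> grind
  have f2 : q.x * q.y * q'.y + q'.y * (q.x * q.y) = (c₂ * β) • (1 : A) := by
    rw [e]
    simp only [mul_add, add_mul, mul_assoc, smul_mul_assoc, mul_smul_comm, h.rules, one_mul,
      mul_one, smul_add]
    match_scalars <;> grind
  rw [← hq']
  change ConnectedByChain 4 0 (h.toQuadruple hd).toUnordered _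
  by_cases hc₃ : c₃ = 0
  · have hc₂ : c₂ ≠ 0 := by
      rintro rfl
      have := h'.left.yx
      rw [e, hc₃] at this
      simp only [zero_smul, add_zero, smul_mul_assoc, one_mul, mul_smul_comm, mul_one,
        left_eq_add, smul_eq_zero, one_ne_zero, or_false] at this
      refine h'.left.y_ne_zero ?_
      rw [e, this, hc₃]
      simp
    have hm : BiquaternionRel α (α * β) γ δ q.x (q.x * q.y) q.z q.u :=
      ⟨h.left.mul_right, h.right, h.zx, h.ux,
        by rw [← mul_assoc, h.zx, mul_assoc, h.zy, mul_assoc],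
        by rw [← mul_assoc, h.ux, mul_assoc, h.uy, mul_assoc]⟩
    have s1 : Lambda1 (h.toQuadruple hd) (hm.toQuadruple hd) := Or.inr (Or.inl ⟨rfl, rfl, rfl⟩)
    exact s1.connected.trans
      (hm.connected_of_commutator hd h'' (mul_ne_zero hc₂ h.left.ne_zero) f2)
  · exact (h.connected_of_commutator hd h'' (mul_ne_zero hc₃ h.left.ne_zero) f1).mono
      (by norm_num) le_rfl

/-- Quadruples with the same quaternion factors are connected by `Λ₁`-steps. -/
theorem GenQuadruple.connected_of_commute (hd : Module.finrank F A = 16)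
    (q q' : GenQuadruple F A) (hxz : q.z * q'.x = q'.x * q.z) (hxu : q.u * q'.x = q'.x * q.u)
    (hyz : q.z * q'.y = q'.y * q.z) (hyu : q.u * q'.y = q'.y * q.u) :
    ConnectedByChain 8 0 q.toUnordered q'.toUnordered := by
  obtain ⟨α, β, γ, δ, h⟩ := q.exists_rel
  obtain ⟨α', β', γ', δ', h'⟩ := q'.exists_rel
  -- The mixed tuple allows the two factors to be treated separately, with four steps each.
  have m : BiquaternionRel α' β' γ δ q'.x q'.y q.z q.u := ⟨h'.left, h.right, hxz, hxu, hyz, hyu⟩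
  have s1 := GenQuadruple.connected_of_right_eq hd q (m.toQuadruple hd) rfl rfl
  have s2 := GenQuadruple.connected_of_right_eq hd (m.toQuadruple hd).swap q'.swap rfl rfl
  rw [toUnordered_swap, toUnordered_swap] at s2
  exact s1.trans s2

end QuaternionChains

/-! ### The canonical involution of a quadruple. -/

section Involution

/-- The map `s` is the tensor product of the canonical involutions of the quaternion factors
generated by `x, y` and by `z, u`. -/
structure IsCanonicalInvolution {F A : Type*} [Field F] [Ring A] [Algebra F A] (s : A →ₗ[F] A)
    (x y z u : A) : Prop where
  map_mul : ∀ a b, s (a * b) = s b * s a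
  map_one : s 1 = 1
  map_x : s x = x + 1
  map_y : s y = y
  map_z : s z = z + 1
  map_u : s u = u

variable {F A : Type*} [Field F] [CharP F 2] [DivisionRing A] [Algebra F A]
variable {α β γ δ : F} {x y z u : A} {s : A →ₗ[F] A}

open MulOpposite in
theorem QuaternionRel.op_conjugate {A : Type*} [Ring A] [Algebra F A] {x y : A}
    (h : QuaternionRel α β x y) : QuaternionRel α β (op (x + 1)) (op y) := by
  refine ⟨h.ne_zero, ?_, ?_, ?_⟩ <;>
  simp only [← op_mul, ← op_add, ← op_smul, ← op_one] <;>
  congr 1 <;>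
  simp only [mul_add, add_mul, mul_one, one_mul, h.rules] <;>
  match_scalars <;> grind

open MulOpposite in
-- The tuple `x + 1, y, z + 1, u` satisfies the same relations in the opposite algebra, so the
-- universal property applies.
theorem BiquaternionRel.exists_involution (h : BiquaternionRel α β γ δ x y z u)
    (hd : Module.finrank F A = 16) : ∃ s : A →ₗ[F] A, IsCanonicalInvolution s x y z u := by
  have H : BiquaternionRel α β γ δ (op (x + 1)) (op y) (op (z + 1)) (op u) := by
    refine ⟨h.left.op_conjugate, h.right.op_conjugate, ?_, ?_, ?_, ?_⟩ <;>
    simp only [← op_mul] <;> congr 1 <;>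
    simp only [mul_add, add_mul, mul_one, one_mul, h.rules]
    abel
  obtain ⟨f, fx, fy, fz, fu⟩ := h.exists_algHom hd H
  exact ⟨(opLinearEquiv F).symm.toLinearMap ∘ₗ f.toLinearMap, by simp, by simp, by simp [fx],
    by simp [fy], by simp [fz], by simp [fu]⟩

/-- Identities between multiplicative expressions which hold on generators hold everywhere. -/
theorem BiquaternionRel.induction (h : BiquaternionRel α β γ δ x y z u)
    (hd : Module.finrank F A = 16) {p : A → Prop} (hx : p x) (hy : p y) (hz : p z) (hu : p u)
    (hs : ∀ c : F, p (c • 1)) (ha : ∀ a b, p a → p b → p (a + b))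
    (hm : ∀ a b, p a → p b → p (a * b)) (a : A) : p a := by
  have : a ∈ Algebra.adjoin F {x, y, z, u} := by
    rw [h.adjoin_eq_top hd]
    trivial
  induction this using Algebra.adjoin_induction with
  | mem b hb =>
    rcases hb with rfl | rfl | rfl | rfl <;> assumption
  | algebraMap c =>
    rw [Algebra.algebraMap_eq_smul_one]
    exact hs c
  | add a b _ _ h1 h2 => exact ha a b h1 h2
  | mul a b _ _ h1 h2 => exact hm a b h1 h2

theorem IsCanonicalInvolution.involutive (hs : IsCanonicalInvolution s x y z u)
    (h : BiquaternionRel α β γ δ x y z u) (hd : Module.finrank F A = 16) (a : A) :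
    s (s a) = a := by
  have h2 : ∀ a : A, a + 1 + 1 = a := fun a => by
    rw [add_assoc, add_self_of_charTwo F, add_zero]
  induction a using h.induction hd with
  | hx => rw [hs.map_x, map_add, hs.map_x, hs.map_one, h2]
  | hy => rw [hs.map_y, hs.map_y]
  | hz => rw [hs.map_z, map_add, hs.map_z, hs.map_one, h2]
  | hu => rw [hs.map_u, hs.map_u]
  | hs c => rw [map_smul, map_smul, hs.map_one, hs.map_one]
  | ha a b h1 h2 => rw [map_add, map_add, h1, h2]
  | hm a b h1 h2 => rw [hs.map_mul, hs.map_mul, h1, h2]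

/-- The elements `a + s a` form the space spanned by `1`, `x + z`, `y`, `x y`, `u`, `z u`. -/
theorem IsCanonicalInvolution.exists_add_eq (hs : IsCanonicalInvolution s x y z u)
    (h : BiquaternionRel α β γ δ x y z u) (hd : Module.finrank F A = 16) (a : A) :
    ∃ t c₀ c₂ c₃ d₂ d₃ : F, a + s a = t • (x + z) +
      (c₀ • 1 + c₂ • y + c₃ • (x * y) + d₂ • u + d₃ • (z * u)) := by
  obtain ⟨r₀, r₁, r₂, r₃, rfl⟩ := h.exists_eq hd a
  refine ⟨r₁.imI, r₀.imI + r₁.re + r₁.imI, r₂.imI, r₃.imI, r₁.imJ, r₁.imK, ?_⟩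
  simp only [h.right.liftHom_basis]
  simp only [map_add, map_smul, hs.map_mul, hs.map_one, hs.map_x, hs.map_y, hs.map_z, hs.map_u]
  simp only [mul_add, add_mul, mul_assoc, smul_mul_assoc, mul_smul_comm, h.rules, mul_one, one_mul,
    smul_add]
  match_scalars <;> grind

end Involution

/-! ### An explicit Skolem–Noether theorem and the comparison of involutions. -/

section Conjugation

variable {F A : Type*} [Field F] [CharP F 2] [DivisionRing A] [Algebra F A]
variable {α β γ δ : F} {x y z u : A}

/-- The image of `a` under this map intertwines `x, y` and `X, Y`. -/
def intertwiner (x y X Y a : A) : A := (Y * a + a * y) + X * (Y * a + a * y) + (Y * a + a * y) * x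

/-- Since `y` and `Y` have the same square, `b = Y a + a y` satisfies `Y b = b y`. Then `b + X b + b
x` also intertwines `x` and `X`, because `x` and `X` have the same α. -/
theorem intertwiner_spec {X Y : A} (h : QuaternionRel α β x y) (H : QuaternionRel α β X Y)
    (a : A) : X * intertwiner x y X Y a = intertwiner x y X Y a * x ∧
      Y * intertwiner x y X Y a = intertwiner x y X Y a * y := by
  constructor <;>
  simp only [intertwiner, mul_add, add_mul, mul_assoc, smul_mul_assoc, mul_smul_comm, h.rules,
    H.rules, mul_one, smul_add] <;>
  match_scalars <;> grind

theorem intertwiner_mul_right {X Y v : A} (hx : x * v = v * x) (hy : y * v = v * y) (a : A) :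
    intertwiner x y X Y (a * v) = intertwiner x y X Y a * v := by
  simp only [intertwiner, add_mul, mul_add, mul_assoc, hx, hy, commute_rules hy]

theorem mul_intertwiner {X Y v : A} (hX : v * X = X * v) (hY : v * Y = Y * v) (a : A) :
    v * intertwiner x y X Y a = intertwiner x y X Y (v * a) := by
  simp only [intertwiner, add_mul, mul_add, mul_assoc, commute_rules hX, commute_rules hY]

/-- The set `B` permits iteration: taking for `B` the intertwiners of one factor produces a common
intertwiner of both. If the map vanished on `B`, combining its values at `b` and `b x`, and then at
`b y`, would give `b y y = 0`. -/
theorem intertwiner_ne_zero {X Y : A} (h : QuaternionRel α β x y) {B : Set A}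
    (hBx : ∀ b ∈ B, b * x ∈ B) (hBy : ∀ b ∈ B, b * y ∈ B) {b₀ : A} (hb₀ : b₀ ∈ B) (h0 : b₀ ≠ 0) :
    ∃ b ∈ B, intertwiner x y X Y b ≠ 0 := by
  by_contra! H
  have e1 : ∀ b ∈ B, b * y + X * (b * y) + b * y * x = 0 := fun b hb => by
    have : intertwiner x y X Y (b * x) + intertwiner x y X Y b * x =
        b * y + X * (b * y) + b * y * x := by
      simp only [intertwiner, mul_add, add_mul, mul_assoc, smul_mul_assoc, mul_smul_comm, h.rules,
        mul_one, smul_add]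
      match_scalars <;> grind
    rw [← this, H _ (hBx b hb), H b hb, zero_mul, add_zero]
  have e2 : b₀ * y * y = 0 := by
    have : (b₀ * y * y + X * (b₀ * y * y) + b₀ * y * y * x) +
        (b₀ * y + X * (b₀ * y) + b₀ * y * x) * y = b₀ * y * y := by
      simp only [mul_add, add_mul, mul_assoc, smul_mul_assoc, mul_smul_comm, h.rules, mul_one]
      match_scalars <;> grind
    rw [← this, e1 _ (hBy b₀ hb₀), e1 _ hb₀, zero_mul, add_zero]
  have hy := h.y_ne_zero
  exact mul_ne_zero (mul_ne_zero h0 hy) hy e2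

/-- Two tuples which satisfy the same relations are conjugate. -/
theorem BiquaternionRel.exists_conjugating {X Y Z U : A} (h : BiquaternionRel α β γ δ x y z u)
    (H : BiquaternionRel α β γ δ X Y Z U) :
    ∃ g : A, g ≠ 0 ∧ X * g = g * x ∧ Y * g = g * y ∧ Z * g = g * z ∧ U * g = g * u := by
  obtain ⟨a, -, ha⟩ := intertwiner_ne_zero (X := Z) (Y := U) h.right (B := Set.univ)
    (fun _ _ => trivial) (fun _ _ => trivial) (b₀ := 1) trivial one_ne_zero
  obtain ⟨b, ⟨hz, hu⟩, hb⟩ := intertwiner_ne_zero (X := X) (Y := Y) h.left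
    (B := {b | Z * b = b * z ∧ U * b = b * u})
    (fun b hb => ⟨by rw [← mul_assoc, hb.1, mul_assoc, h.zx, mul_assoc],
      by rw [← mul_assoc, hb.2, mul_assoc, h.ux, mul_assoc]⟩)
    (fun b hb => ⟨by rw [← mul_assoc, hb.1, mul_assoc, h.zy, mul_assoc],
      by rw [← mul_assoc, hb.2, mul_assoc, h.uy, mul_assoc]⟩)
    (intertwiner_spec h.right H.right a) ha
  refine ⟨_, hb, (intertwiner_spec h.left H.left b).1, (intertwiner_spec h.left H.left b).2, ?_, ?_⟩
  · rw [mul_intertwiner H.zx H.zy, hz, intertwiner_mul_right h.zx.symm h.zy.symm]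
  · rw [mul_intertwiner H.ux H.uy, hu, intertwiner_mul_right h.ux.symm h.uy.symm]

/-- Two canonical involutions differ by conjugation with an element `g` of the form `c + s c`. -/
theorem IsCanonicalInvolution.exists_conjugating {x' y' z' u' : A} {s s' : A →ₗ[F] A}
    (hs : IsCanonicalInvolution s x y z u) (hs' : IsCanonicalInvolution s' x' y' z' u')
    (h : BiquaternionRel α β γ δ x y z u) (hd : Module.finrank F A = 16) :
    ∃ g : A, g ≠ 0 ∧ ∀ a, s' a * g = g * s a := by
  have q1 : ∀ {α β : F} {x y : A}, QuaternionRel α β x y →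
      QuaternionRel α β (s' x + 1) (s' y) := fun {α β x y} r => by
    have e1 := congrArg s' r.xx
    have e2 := congrArg s' r.yy
    have e3 := congrArg s' r.rules.1.2.2
    simp only [map_add, map_smul, hs'.map_mul, hs'.map_one] at e1 e2 e3
    refine ⟨r.ne_zero, ?_, e2, ?_⟩ <;>
    simp only [mul_add, add_mul, e1, mul_one, one_mul, e3] <;>
    match_scalars <;> grind
  have q2 : ∀ {a b : A}, a * b = b * a → s' a * s' b = s' b * s' a := fun {a b} r => by
    rw [← hs'.map_mul, ← r, hs'.map_mul]
  -- This is the image of the tuple under the homomorphism `s' ∘ s`.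
  have H : BiquaternionRel α β γ δ (s' x + 1) (s' y) (s' z + 1) (s' u) := by
    refine ⟨q1 h.left, q1 h.right, ?_, ?_, ?_, ?_⟩ <;>
    simp only [mul_add, add_mul, mul_one, one_mul, q2 h.zx, q2 h.zy, q2 h.ux, q2 h.uy]
    abel
  obtain ⟨g, hg, gx, gy, gz, gu⟩ := h.exists_conjugating H
  refine ⟨g, hg, fun a => ?_⟩
  have q3 : ∀ {a b : A}, (a + 1) * g = g * b → a * g = g * (b + 1) := fun {a b} r => by
    rw [mul_add, ← r, add_mul, mul_one, one_mul, add_assoc, add_self_of_charTwo F, add_zero]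
  induction a using h.induction hd with
  | hx => rw [hs.map_x, q3 gx]
  | hy => rw [hs.map_y, gy]
  | hz => rw [hs.map_z, q3 gz]
  | hu => rw [hs.map_u, gu]
  | hs c => simp [hs.map_one, hs'.map_one]
  | ha a b h1 h2 => rw [map_add, map_add, add_mul, mul_add, h1, h2]
  | hm a b h1 h2 => rw [hs.map_mul, hs'.map_mul, mul_assoc, h1, ← mul_assoc, h2, mul_assoc]

theorem IsCanonicalInvolution.exists_eq_of_conjugating {α' β' γ' δ' : F} {x' y' z' u' : A}
    {s s' : A →ₗ[F] A} (hs : IsCanonicalInvolution s x y z u)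
    (hs' : IsCanonicalInvolution s' x' y' z' u') (h : BiquaternionRel α β γ δ x y z u)
    (h' : BiquaternionRel α' β' γ' δ' x' y' z' u') (hd : Module.finrank F A = 16) {g : A}
    (hg : g ≠ 0) (hgs : ∀ a, s' a * g = g * s a) :
    s g = g ∧ ∃ t c₀ c₂ c₃ d₂ d₃ : F, g = t • (x + z) +
      (c₀ • 1 + c₂ • y + c₃ • (x * y) + d₂ • u + d₃ • (z * u)) := by
  have h1 : ∀ b, s' b * s g = s g * s b := fun b => by
    have := congrArg s (hgs (s' b))
    rw [hs'.involutive h' hd, hs.map_mul, hs.map_mul, hs.involutive h hd] at this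
    exact this.symm
  -- Both `g` and `s g` intertwine `s` and `s'`, so their quotient is a central scalar `c`; then `c
  -- ^ 2 = 1` forces `c = 1` in characteristic 2.
  have h2 : ∀ b, b * (g⁻¹ * s g) = g⁻¹ * s g * b := fun b => by
    have e := h1 (s b)
    rw [hs.involutive h hd] at e
    have e' := hgs (s b)
    rw [hs.involutive h hd] at e'
    rw [mul_assoc, ← e, ← mul_assoc, ← mul_assoc]
    congr 1
    rw [eq_inv_mul_iff_mul_eq₀ hg, ← mul_assoc, ← e', mul_assoc, mul_inv_cancel₀ hg, mul_one]
  obtain ⟨c, hc⟩ := h.exists_of_central hd (h2 x) (h2 y) (h2 z) (h2 u)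
  have hc' : s g = c • g := by
    rw [← mul_inv_cancel_left₀ hg (s g), hc, mul_smul_comm, mul_one]
  have hc1 : c = 1 := by
    have e := hs.involutive h hd g
    rw [hc', map_smul, hc', smul_smul] at e
    have e2 : (c * c + 1) • g = 0 := by
      rw [add_smul, e, one_smul, add_self_of_charTwo F]
    have e3 : (c + 1) * (c + 1) = 0 := by
      have := (smul_eq_zero.1 e2).resolve_right hg
      grind
    have e4 := mul_self_eq_zero.1 e3
    grind
  have hsg : s g = g := by rw [hc', hc1, one_smul]
  refine ⟨hsg, ?_⟩
  -- As `s (x' g) = g (s x') = (s' x') g = (x' + 1) g`, the element `x' g + s (x' g)` is `g`.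
  obtain ⟨t, c₀, c₂, c₃, d₂, d₃, e⟩ := hs.exists_add_eq h hd (x' * g)
  refine ⟨t, c₀, c₂, c₃, d₂, d₃, ?_⟩
  rw [← e, hs.map_mul, hsg, ← hgs, hs'.map_x, add_mul, ← add_assoc, add_self_of_charTwo F,
    zero_add, one_mul]

end Conjugation

/-! ### Changing the involution by steps Ω_s. -/

section SymmetricSteps

open GenQuadruple

theorem QuaternionRel.y_not_scalar {F A : Type*} [Field F] [DivisionRing A] [Algebra F A]
    {α β : F} {x y : A} (h : QuaternionRel α β x y) (c : F) : y ≠ c • 1 := by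
  rintro rfl
  have := h.yx
  simp only [smul_mul_assoc, one_mul, mul_smul_comm, mul_one, left_eq_add] at this
  exact h.y_ne_zero this

variable {F A : Type*} [Field F] [CharP F 2] [DivisionRing A] [Algebra F A]
variable {α β γ δ : F} {x y z u : A} {s s' : A →ₗ[F] A}

/-- Adding `d x y` to `x` changes its commutator with `y` by `d β`, which the shift of `y`
compensates. -/
theorem QuaternionRel.shift (h : QuaternionRel α β x y) (a c d : F) :
    QuaternionRel (a * a + a + α + β * (c * c + c * d + d * d * α)) (β + d * β * (d * β))
      (x + (a • 1 + c • y + d • (x * y))) (y + (d * β) • 1) := by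
  have hyy : (y + (d * β) • (1 : A)) * (y + (d * β) • 1) = (β + d * β * (d * β)) • 1 := by
    simp only [mul_add, add_mul, smul_mul_assoc, mul_smul_comm, h.rules, one_mul, mul_one]
    match_scalars <;> grind
  refine ⟨fun h0 => ?_, ?_, hyy, ?_⟩
  · rw [h0, zero_smul, mul_self_eq_zero, add_eq_zero_iff_of_charTwo F] at hyy
    exact h.y_not_scalar _ hyy
  all_goals
    simp only [mul_add, add_mul, mul_assoc, smul_mul_assoc, mul_smul_comm, h.rules, one_mul,
      mul_one, smul_add]
    match_scalars <;> grind

theorem BiquaternionRel.shift (h : BiquaternionRel α β γ δ x y z u) (c₀ c₂ c₃ d₂ d₃ : F) :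
    ∃ α' β' γ' δ' : F, BiquaternionRel α' β' γ' δ'
      (x + ((0 : F) • 1 + c₂ • y + c₃ • (x * y))) (y + (c₃ * β) • 1)
      (z + (c₀ • 1 + d₂ • u + d₃ • (z * u))) (u + (d₃ * δ) • 1) := by
  refine ⟨_, _, _, _, h.left.shift 0 c₂ c₃, h.right.shift c₀ d₂ d₃, ?_, ?_, ?_, ?_⟩ <;>
  simp only [mul_add, add_mul, mul_assoc, smul_mul_assoc, mul_smul_comm, h.rules, one_mul,
    mul_one, smul_add] <;>
  module

theorem IsCanonicalInvolution.shift (hs : IsCanonicalInvolution s x y z u)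
    (h : BiquaternionRel α β γ δ x y z u) (c₀ c₂ c₃ d₂ d₃ : F) :
    IsCanonicalInvolution s
      (x + ((0 : F) • 1 + c₂ • y + c₃ • (x * y))) (y + (c₃ * β) • 1)
      (z + (c₀ • 1 + d₂ • u + d₃ • (z * u))) (u + (d₃ * δ) • 1) := by
  refine ⟨hs.map_mul, hs.map_one, ?_, ?_, ?_, ?_⟩ <;>
  simp only [map_add, map_smul, hs.map_mul, hs.map_one, hs.map_x, hs.map_y, hs.map_z, hs.map_u,
    mul_add, h.rules, mul_one] <;>
  match_scalars <;> grind

theorem BiquaternionRel.add_not_scalar (h : BiquaternionRel α β γ δ x y z u) (c : F) :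
    x + z ≠ c • 1 := by
  intro h0
  refine h.left.y_ne_zero ?_
  have e : y * (x + z) + (x + z) * y = y := by
    simp only [mul_add, add_mul, h.rules]
    match_scalars <;> grind
  rw [← e, h0]
  simp [add_self_of_charTwo F]

theorem BiquaternionRel.add_mul_add (h : BiquaternionRel α β γ δ x y z u) :
    (x + z) * (x + z) = (x + z) + (α + γ) • 1 := by
  simp only [mul_add, add_mul, h.rules]
  match_scalars <;> grind

theorem BiquaternionRel.omegaS (h : BiquaternionRel α β γ δ x y z u) :
    BiquaternionRel α ((α + γ) * β) γ ((α + γ) * δ) x ((x + z) * y) z ((x + z) * u) := by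
  -- Otherwise `x + z` would be idempotent, hence `0` or `1`.
  have h0 : α + γ ≠ 0 := fun h0 => by
    have e := h.add_mul_add
    rw [h0, zero_smul, add_zero, ← sub_eq_zero, ← mul_sub_one, mul_eq_zero, sub_eq_zero] at e
    rcases e with e | e
    · exact h.add_not_scalar 0 (by rw [e, zero_smul])
    · exact h.add_not_scalar 1 (by rw [e, one_smul])
  refine ⟨⟨mul_ne_zero h0 h.left.ne_zero, h.left.xx, ?_, ?_⟩,
    ⟨mul_ne_zero h0 h.right.ne_zero, h.right.xx, ?_, ?_⟩, h.zx, ?_, ?_, ?_⟩ <;>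
  simp only [mul_add, add_mul, mul_assoc, mul_smul_comm, h.rules, mul_one, smul_add] <;>
  match_scalars <;> grind

theorem IsCanonicalInvolution.omegaS (hs : IsCanonicalInvolution s x y z u)
    (h : BiquaternionRel α β γ δ x y z u) (hm : ∀ a b, s' (a * b) = s' b * s' a)
    (h1 : s' 1 = 1) (hg : ∀ a, s' a * (x + z) = (x + z) * s a) :
    IsCanonicalInvolution s' x ((x + z) * y) z ((x + z) * u) := by
  have h0 : x + z ≠ 0 := fun h0 => h.add_not_scalar 0 (by rw [h0, zero_smul])
  have hsg : s (x + z) = x + z := by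
    rw [map_add, hs.map_x, hs.map_z, add_add_add_comm, add_self_of_charTwo F, add_zero]
  refine ⟨hm, h1, ?_, ?_, ?_, ?_⟩ <;> refine mul_right_cancel₀ h0 ?_ <;> rw [hg]
  · simp only [hs.map_x, mul_add, add_mul, one_mul, mul_one, h.zx]
    abel
  · rw [hs.map_mul, hsg, hs.map_y, mul_assoc]
  · simp only [hs.map_z, mul_add, add_mul, one_mul, mul_one, h.zx]
    abel
  · rw [hs.map_mul, hsg, hs.map_u, mul_assoc]

/-- Conjugation of an involution with `x + z + w` amounts to a step of type `Ω_s`. -/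
theorem GenQuadruple.exists_omegaS (hd : Module.finrank F A = 16) (q : GenQuadruple F A)
    (hs : IsCanonicalInvolution s q.x q.y q.z q.u) (hm : ∀ a b, s' (a * b) = s' b * s' a)
    (h1 : s' 1 = 1) (c₀ c₂ c₃ d₂ d₃ : F)
    (hg : ∀ a, s' a * ((q.x + q.z) + (c₀ • 1 + c₂ • q.y + c₃ • (q.x * q.y) + d₂ • q.u +
      d₃ • (q.z * q.u))) = ((q.x + q.z) + (c₀ • 1 + c₂ • q.y + c₃ • (q.x * q.y) + d₂ • q.u +
      d₃ • (q.z * q.u))) * s a) :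
    ∃ q' : GenQuadruple F A, ConnectedByChain 9 1 q.toUnordered q'.toUnordered ∧
      IsCanonicalInvolution s' q'.x q'.y q'.z q'.u := by
  obtain ⟨α, β, γ, δ, h⟩ := q.exists_rel
  obtain ⟨α', β', γ', δ', h'⟩ := h.shift c₀ c₂ c₃ d₂ d₃
  have hs' := hs.shift h c₀ c₂ c₃ d₂ d₃
  have c1 := GenQuadruple.connected_of_commute hd q (h'.toQuadruple hd)
    (by simp only [BiquaternionRel.toQuadruple, mul_add, add_mul, mul_assoc, smul_mul_assoc,
          mul_smul_comm, h.rules, one_mul, mul_one])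
    (by simp only [BiquaternionRel.toQuadruple, mul_add, add_mul, mul_assoc, smul_mul_assoc,
          mul_smul_comm, h.rules, one_mul, mul_one])
    (by simp only [BiquaternionRel.toQuadruple, mul_add, add_mul, smul_mul_assoc,
          mul_smul_comm, h.rules, one_mul, mul_one])
    (by simp only [BiquaternionRel.toQuadruple, mul_add, add_mul, smul_mul_assoc,
          mul_smul_comm, h.rules, one_mul, mul_one])
  -- The shift has turned the conjugating element into the sum of the new `x` and `z`, so Ω_s is
  -- applied with `a = 0`, `b = 1`.
  have c2 : Omega (h'.toQuadruple hd) (h'.omegaS.toQuadruple hd) :=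
    Or.inr (Or.inl ⟨0, 1, rfl, rfl, by simp [BiquaternionRel.toQuadruple],
      by simp [BiquaternionRel.toQuadruple]⟩)
  refine ⟨h'.omegaS.toQuadruple hd, c1.trans c2.connected, hs'.omegaS h' hm h1 ?_⟩
  have e : q.x + ((0 : F) • 1 + c₂ • q.y + c₃ • (q.x * q.y)) +
      (q.z + (c₀ • 1 + d₂ • q.u + d₃ • (q.z * q.u))) = (q.x + q.z) + (c₀ • 1 + c₂ • q.y +
      c₃ • (q.x * q.y) + d₂ • q.u + d₃ • (q.z * q.u)) := by module
  rw [e]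
  exact hg

/-- The coefficient `t` of `x + z` acts as a trace: the square is scalar when `t = 0`. -/
theorem BiquaternionRel.sq_symmetric (h : BiquaternionRel α β γ δ x y z u)
    (t c₀ c₂ c₃ d₂ d₃ : F) : ∃ N : F,
    (t • (x + z) + (c₀ • 1 + c₂ • y + c₃ • (x * y) + d₂ • u + d₃ • (z * u))) *
      (t • (x + z) + (c₀ • 1 + c₂ • y + c₃ • (x * y) + d₂ • u + d₃ • (z * u))) =
    t • (t • (x + z) + (c₀ • 1 + c₂ • y + c₃ • (x * y) + d₂ • u + d₃ • (z * u))) + N • 1 := by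
  refine ⟨t * t * (α + γ) + t * c₀ + c₀ * c₀ + β * (c₂ * c₂ + c₂ * c₃ + c₃ * c₃ * α) +
    δ * (d₂ * d₂ + d₂ * d₃ + d₃ * d₃ * γ), ?_⟩
  simp only [mul_add, add_mul, mul_assoc, smul_mul_assoc, mul_smul_comm, h.rules, one_mul,
    mul_one, smul_add]
  match_scalars <;> grind

theorem BiquaternionRel.commutator_symmetric (h : BiquaternionRel α β γ δ x y z u)
    (c₀ c₂ c₃ d₂ d₃ c₂' c₃' d₂' d₃' : F) :
    ((x + z) + ((0 : F) • 1 + c₂' • y + c₃' • (x * y) + d₂' • u + d₃' • (z * u))) *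
      (c₀ • 1 + c₂ • y + c₃ • (x * y) + d₂ • u + d₃ • (z * u)) =
    (c₀ • 1 + c₂ • y + c₃ • (x * y) + d₂ • u + d₃ • (z * u)) *
      ((x + z) + ((0 : F) • 1 + c₂' • y + c₃' • (x * y) + d₂' • u + d₃' • (z * u))) +
    ((c₀ • 1 + c₂ • y + c₃ • (x * y) + d₂ • u + d₃ • (z * u)) +
      (c₀ + β * (c₂ * c₃' + c₃ * c₂') + δ * (d₂ * d₃' + d₃ * d₂')) • 1) := by
  simp only [mul_add, add_mul, mul_assoc, smul_mul_assoc, mul_smul_comm, h.rules, one_mul,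
    mul_one, smul_add]
  match_scalars <;> grind

/-- Two involutions are related by at most two steps of type `Ω_s`. -/
theorem GenQuadruple.exists_connected_of_involution (hd : Module.finrank F A = 16)
    (q q' : GenQuadruple F A) (hs' : IsCanonicalInvolution s' q'.x q'.y q'.z q'.u) :
    ∃ q₂ : GenQuadruple F A, ConnectedByChain 18 2 q.toUnordered q₂.toUnordered ∧
      IsCanonicalInvolution s' q₂.x q₂.y q₂.z q₂.u := by
  have step : ∀ (q : GenQuadruple F A) (s : A →ₗ[F] A),
      IsCanonicalInvolution s q.x q.y q.z q.u → ∀ t c₀ c₂ c₃ d₂ d₃ : F, t ≠ 0 →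
      (∀ a, s' a * (t • (q.x + q.z) + (c₀ • 1 + c₂ • q.y + c₃ • (q.x * q.y) + d₂ • q.u +
        d₃ • (q.z * q.u))) = (t • (q.x + q.z) + (c₀ • 1 + c₂ • q.y + c₃ • (q.x * q.y) +
        d₂ • q.u + d₃ • (q.z * q.u))) * s a) →
      ∃ q₂ : GenQuadruple F A, ConnectedByChain 9 1 q.toUnordered q₂.toUnordered ∧
      IsCanonicalInvolution s' q₂.x q₂.y q₂.z q₂.u := by
    intro q s hs t c₀ c₂ c₃ d₂ d₃ ht hg
    refine q.exists_omegaS hd hs hs'.map_mul hs'.map_one (t⁻¹ * c₀) (t⁻¹ * c₂) (t⁻¹ * c₃)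
      (t⁻¹ * d₂) (t⁻¹ * d₃) fun a => ?_
    have e : (q.x + q.z) + ((t⁻¹ * c₀) • 1 + (t⁻¹ * c₂) • q.y + (t⁻¹ * c₃) • (q.x * q.y) +
        (t⁻¹ * d₂) • q.u + (t⁻¹ * d₃) • (q.z * q.u)) = t⁻¹ • (t • (q.x + q.z) + (c₀ • 1 +
        c₂ • q.y + c₃ • (q.x * q.y) + d₂ • q.u + d₃ • (q.z * q.u))) := by
      match_scalars <;> field_simp
    rw [e, mul_smul_comm, hg, smul_mul_assoc]
  obtain ⟨α, β, γ, δ, h⟩ := q.exists_rel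
  obtain ⟨α', β', γ', δ', h'⟩ := q'.exists_rel
  obtain ⟨s, hs⟩ := h.exists_involution hd
  obtain ⟨g, hg0, hg⟩ := hs.exists_conjugating hs' h hd
  obtain ⟨-, t, c₀, c₂, c₃, d₂, d₃, e⟩ := hs.exists_eq_of_conjugating hs' h h' hd hg0 hg
  by_cases ht : t = 0
  swap
  · obtain ⟨q₂, hq₂, hsq₂⟩ := step q s hs t c₀ c₂ c₃ d₂ d₃ ht (by rwa [← e])
    exact ⟨q₂, hq₂.mono (by norm_num) (by norm_num), hsq₂⟩
  have e' : g = c₀ • 1 + c₂ • q.y + c₃ • (q.x * q.y) + d₂ • q.u + d₃ • (q.z * q.u) := by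
    rw [e, ht, zero_smul, zero_add]
  -- This expression is affine in the primed variables; if it vanished at the origin and the unit
  -- vectors, `g` would be `0`.
  obtain ⟨c₂', c₃', d₂', d₃', hμ⟩ : ∃ c₂' c₃' d₂' d₃' : F,
      c₀ + β * (c₂ * c₃' + c₃ * c₂') + δ * (d₂ * d₃' + d₃ * d₂') ≠ 0 := by
    by_contra! H
    have H0 := H 0 0 0 0
    have H1 := H 0 1 0 0
    have H2 := H 1 0 0 0
    have H3 := H 0 0 0 1
    have H4 := H 0 0 1 0
    have hβ := h.left.ne_zero
    have hδ := h.right.ne_zero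
    simp only [mul_zero, add_zero] at H0
    subst H0
    simp [hβ, hδ] at H1 H2 H3 H4
    simp [e', H1, H2, H3, H4] at hg0
  set g₀ : A := (q.x + q.z) + ((0 : F) • 1 + c₂' • q.y + c₃' • (q.x * q.y) + d₂' • q.u +
    d₃' • (q.z * q.u)) with hg₀
  set μ := c₀ + β * (c₂ * c₃' + c₃ * c₂') + δ * (d₂ * d₃' + d₃ * d₂')
  have comm : g₀ * g = g * g₀ + (g + μ • 1) := by
    rw [e']
    exact h.commutator_symmetric _ _ _ _ _ _ _ _ _
  clear_value μ
  have g₀_not : ∀ c : F, g₀ ≠ c • 1 := fun c hc => by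
    obtain ⟨_, _, _, _, hh⟩ := h.shift 0 c₂' c₃' d₂' d₃'
    refine hh.add_not_scalar c ?_
    rw [← hc, hg₀]
    module
  have g₀_ne : g₀ ≠ 0 := fun h0 => g₀_not 0 (by rw [h0, zero_smul])
  let s₁ : A →ₗ[F] A := LinearMap.mulRight F g₀⁻¹ ∘ₗ LinearMap.mulLeft F g₀ ∘ₗ s
  have hs₁ : ∀ a, s₁ a = g₀ * s a * g₀⁻¹ := fun a => rfl
  have hs₁g : ∀ a, s₁ a * g₀ = g₀ * s a := fun a => by
    rw [hs₁, inv_mul_cancel_right₀ g₀_ne]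
  obtain ⟨q₁, hq₁, hsq₁⟩ := q.exists_omegaS (s' := s₁) hd hs
    (fun a b => by
      simp only [hs₁, hs.map_mul, mul_assoc]
      rw [inv_mul_cancel_left₀ g₀_ne])
    (by rw [hs₁, hs.map_one, mul_one, mul_inv_cancel₀ g₀_ne]) 0 c₂' c₃' d₂' d₃' hs₁g
  obtain ⟨α₁, β₁, γ₁, δ₁, h₁⟩ := q₁.exists_rel
  -- It remains to pass from `s₁` to `s'`, and the conjugating element is now `g g₀⁻¹`.
  have hg₁ : ∀ a, s' a * (g * g₀⁻¹) = g * g₀⁻¹ * s₁ a := fun a => by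
    rw [hs₁, ← mul_assoc, hg, ← mul_assoc, ← mul_assoc, inv_mul_cancel_right₀ g₀_ne]
  obtain ⟨-, t₁, b₀, b₂, b₃, a₂, a₃, f⟩ := hsq₁.exists_eq_of_conjugating hs' h₁ h' hd
    (mul_ne_zero hg0 (inv_ne_zero g₀_ne)) hg₁
  by_cases ht₁ : t₁ = 0
  swap
  · obtain ⟨q₂, hq₂, hsq₂⟩ := step q₁ s₁ hsq₁ t₁ b₀ b₂ b₃ a₂ a₃ ht₁ (by rwa [← f])
    exact ⟨q₂, hq₁.trans hq₂, hsq₂⟩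
  -- If `x + z` is missing again, both `g` and `g g₀⁻¹` have scalar squares.
  exfalso
  obtain ⟨N, hN⟩ := h.sq_symmetric t c₀ c₂ c₃ d₂ d₃
  rw [← e, ht, zero_smul, zero_add] at hN
  obtain ⟨M, hM⟩ := h₁.sq_symmetric t₁ b₀ b₂ b₃ a₂ a₃
  rw [← f, ht₁, zero_smul, zero_add] at hM
  obtain ⟨K, hK⟩ := h.sq_symmetric 1 0 c₂' c₃' d₂' d₃'
  rw [one_smul, ← hg₀, one_smul] at hK
  have hN0 : N ≠ 0 := by
    rintro rfl
    rw [zero_smul] at hN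
    exact mul_ne_zero hg0 hg0 hN
  have hM0 : M ≠ 0 := by
    rintro rfl
    rw [zero_smul] at hM
    exact mul_ne_zero (mul_ne_zero hg0 (inv_ne_zero g₀_ne))
      (mul_ne_zero hg0 (inv_ne_zero g₀_ne)) hM
  -- `g₀ * g` is a scalar multiple of `g * g₀⁻¹`, so its square is a scalar
  have k1 : g * g₀⁻¹ * g = M • g₀ := by
    have : g * g₀⁻¹ * (g * g₀⁻¹) * g₀ = g * g₀⁻¹ * g := by
      rw [mul_assoc _ _ g₀, inv_mul_cancel_right₀ g₀_ne]
    rw [← this, hM, smul_one_mul]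
  have k2 : N • (g * g₀⁻¹) = M • (g₀ * g) := by
    rw [← smul_mul_assoc M g₀ g, ← k1, mul_assoc _ g g, hN, mul_smul_comm, mul_one]
  have k3 : g₀ * g * (g₀ * g) = (M⁻¹ * N * (M⁻¹ * N) * M) • 1 := by
    have : g₀ * g = (M⁻¹ * N) • (g * g₀⁻¹) := by
      rw [mul_smul, k2, smul_smul, inv_mul_cancel₀ hM0, one_smul]
    rw [this, smul_mul_smul_comm, hM, smul_smul]
  -- A second evaluation, from `g₀ ^ 2 = g₀ + K` and `g g₀ = g₀ g + g + μ`. As `μ ≠ 0`, the product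
  -- `g₀ g` is scalar; hence `g` commutes with `g₀`, so `g = μ` and `g₀` is scalar, a contradiction.
  have k4 : g₀ * g * (g₀ * g) = (K * N) • 1 + μ • (g₀ * g) := by
    have : g₀ * g * (g₀ * g) = g₀ * (g₀ * g + (g + μ • 1)) * g := by
      have hc : g * g₀ = g₀ * g + (g + μ • 1) := by
        rw [comm, add_assoc, add_self_of_charTwo F, add_zero]
      rw [← hc]
      simp only [mul_assoc]
    rw [this]
    have hgg : ∀ a : A, a * g * g = N • a := fun a => by rw [mul_assoc, hN, mul_smul_comm, mul_one]
    simp only [mul_add, add_mul, ← mul_assoc, hgg, hK, hN, mul_smul_comm, smul_mul_assoc, mul_one,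
      one_mul]
    match_scalars <;> grind
  have k5 : g₀ * g = (μ⁻¹ * (M⁻¹ * N * (M⁻¹ * N) * M + K * N)) • 1 := by
    have : μ • (g₀ * g) = (M⁻¹ * N * (M⁻¹ * N) * M + K * N) • 1 := by
      rw [add_smul, ← k3, k4]
      match_scalars <;> grind
    rw [mul_smul, ← this, smul_smul, inv_mul_cancel₀ hμ, one_smul]
  have k6 : g₀ * g = g * g₀ := by
    refine mul_left_cancel₀ g₀_ne ?_
    rw [← mul_assoc g₀ g g₀, k5]
    simp
  rw [k6, left_eq_add, add_eq_zero_iff_of_charTwo F] at comm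
  rw [comm, mul_smul_comm, mul_one] at k5
  refine g₀_not (μ⁻¹ * (μ⁻¹ * (M⁻¹ * N * (M⁻¹ * N) * M + K * N))) ?_
  rw [mul_smul, ← k5, smul_smul, inv_mul_cancel₀ hμ, one_smul]

end SymmetricSteps

/-! ### Quadruples with the same involution, and steps Ω_i. -/

section SameInvolution

open GenQuadruple

theorem IsCanonicalInvolution.swap {F A : Type*} [Field F] [Ring A] [Algebra F A]
    {s : A →ₗ[F] A} {x y z u : A} (hs : IsCanonicalInvolution s x y z u) :
    IsCanonicalInvolution s z u x y :=
  ⟨hs.map_mul, hs.map_one, hs.map_z, hs.map_u, hs.map_x, hs.map_y⟩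

variable {F A : Type*} [Field F] [CharP F 2] [DivisionRing A] [Algebra F A]
variable {α β γ δ α' β' γ' δ' : F} {x y z u x' y' z' u' : A} {s : A →ₗ[F] A}

/-- Tuples with the same canonical involution have the same space of square-central elements
`F + F y + F x y + F u + F z u`. -/
theorem IsCanonicalInvolution.exists_y_eq (hs : IsCanonicalInvolution s x y z u)
    (hs' : IsCanonicalInvolution s x' y' z' u') (h : BiquaternionRel α β γ δ x y z u)
    (h' : BiquaternionRel α' β' γ' δ' x' y' z' u') (hd : Module.finrank F A = 16) :
    ∃ c₀ c₂ c₃ d₂ d₃ : F, y' = c₀ • 1 + c₂ • y + c₃ • (x * y) + d₂ • u + d₃ • (z * u) := by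
  obtain ⟨t, c₀, c₂, c₃, d₂, d₃, e⟩ := hs.exists_add_eq h hd (y' * z')
  have e' : y' * z' + s (y' * z') = y' := by
    rw [hs'.map_mul, hs'.map_y, hs'.map_z, add_mul, h'.zy, one_mul, ← add_assoc,
      add_self_of_charTwo F, zero_add]
  rw [e'] at e
  obtain ⟨N, hN⟩ := h.sq_symmetric t c₀ c₂ c₃ d₂ d₃
  rw [← e, h'.left.yy] at hN
  -- If `t ≠ 0`, then `t y' = y' ^ 2 + N` would make `y'` a scalar.
  by_cases ht : t = 0
  · exact ⟨c₀, c₂, c₃, d₂, d₃, by rw [e, ht, zero_smul, zero_add]⟩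
  · refine absurd ?_ (h'.left.y_not_scalar (t⁻¹ * (β' + N)))
    have : t • y' = (β' + N) • 1 := by
      rw [add_smul, hN]
      match_scalars <;> grind
    rw [mul_smul, ← this, smul_smul, inv_mul_cancel₀ ht, one_smul]

theorem BiquaternionRel.omegaI (h : BiquaternionRel α β γ δ x y z u) (b : F) :
    BiquaternionRel (α + b * b * β * δ) β (γ + b * b * β * δ) δ (x + b • (y * u)) y
      (z + b • (y * u)) u := by
  refine ⟨⟨h.left.ne_zero, ?_, h.left.yy, ?_⟩, ⟨h.right.ne_zero, ?_, h.right.yy, ?_⟩,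
    ?_, ?_, ?_, h.uy⟩ <;>
  simp only [mul_add, add_mul, mul_assoc, smul_mul_assoc, mul_smul_comm, h.rules, mul_one,
    smul_add] <;>
  match_scalars <;> grind

/-- This makes `d₂ u + d₃ z u` a multiple of an admissible new `u`; when it is zero, the old `u` is
kept with multiplier `0`. -/
theorem QuaternionRel.exists_smul_eq (h : QuaternionRel γ δ z u) (d₂ d₃ : F) :
    ∃ a p r δ' : F, QuaternionRel γ δ' z (p • u + r • (z * u)) ∧
      a • (p • u + r • (z * u)) = d₂ • u + d₃ • (z * u) := by
  by_cases hd : d₂ = 0 ∧ d₃ = 0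
  · refine ⟨0, 1, 0, δ, ?_, ?_⟩
    · rw [one_smul, zero_smul, add_zero]
      exact h
    · rw [hd.1, hd.2]
      simp
  · have hyy : (d₂ • u + d₃ • (z * u)) * (d₂ • u + d₃ • (z * u)) =
        (δ * (d₂ * d₂ + d₂ * d₃ + d₃ * d₃ * γ)) • 1 := by
      simp only [mul_add, add_mul, mul_assoc, smul_mul_assoc, mul_smul_comm, h.rules, mul_one,
        smul_add]
      match_scalars <;> grind
    refine ⟨1, d₂, d₃, _, ⟨fun h0 => hd ?_, h.xx, hyy, ?_⟩, one_smul _ _⟩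
    · rw [h0, zero_smul, mul_self_eq_zero] at hyy
      have := h.independent_smul (c₀ := 0) (c₁ := 0) (c₂ := d₂) (c₃ := d₃) (by simpa using hyy)
      exact this.2.2
    · simp only [mul_add, add_mul, mul_assoc, smul_mul_assoc, mul_smul_comm, h.rules]
      match_scalars <;> grind

/-- Given elements `y` and `y'` with `y y' + y' y = e` in the space of square-central elements, a
step of type `Ω_i` leads to a quadruple one of whose factors is generated by `y` and `y'`. -/
theorem BiquaternionRel.exists_omegaI (hd : Module.finrank F A = 16)
    (h : BiquaternionRel α β γ δ x y z u) {c₀ c₂ c₃ d₂ d₃ e : F} (he : e ≠ 0)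
    (hy' : y' = c₀ • 1 + c₂ • y + c₃ • (x * y) + d₂ • u + d₃ • (z * u))
    (hyy : y * y' + y' * y = e • 1) :
    ∃ q : GenQuadruple F A, q.x = e⁻¹ • (y * y') ∧ q.y = y ∧
      ConnectedByChain 3 1 (h.toQuadruple hd).toUnordered q.toUnordered ∧
      ConnectedByChain 3 1 q.toUnordered (h.toQuadruple hd).toUnordered := by
  obtain ⟨a, p, r, δ₁, hu, ha⟩ := h.right.exists_smul_eq d₂ d₃
  -- Only this part of `y'`, in the first factor, contributes to the polar value with `y`.
  set v := c₀ • 1 + c₂ • y + c₃ • (x * y) with hv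
  have hyv : y * v + v * y = e • 1 := by
    rw [← hyy, hy', hv]
    simp only [mul_add, add_mul, mul_assoc, smul_mul_assoc, mul_smul_comm, h.rules, mul_one,
      one_mul, smul_add]
    match_scalars <;> grind
  have hvv : v * v = (c₀ * c₀ + β * (c₂ * c₂ + c₂ * c₃ + c₃ * c₃ * α)) • 1 := by
    have := h.left.sq_add c₀ 0 c₂ c₃
    simpa only [zero_smul, add_zero, mul_zero, zero_mul, zero_add] using this
  have hv0 : c₀ * c₀ + β * (c₂ * c₂ + c₂ * c₃ + c₃ * c₃ * α) ≠ 0 := fun h0 => by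
    rw [h0, zero_smul, mul_self_eq_zero] at hvv
    rw [hvv, mul_zero, zero_mul, add_zero, eq_comm, smul_eq_zero] at hyv
    exact hyv.elim he one_ne_zero
  obtain ⟨α₁, hx⟩ : ∃ α₁, QuaternionRel α₁ β (e⁻¹ • (y * v)) y :=
    ⟨_, (QuaternionRel.of_commutator h.left.ne_zero hv0 he h.left.yy hvv hyv).1⟩
  have h₁ : BiquaternionRel α₁ β γ δ (e⁻¹ • (y * v)) y z u := by
    refine ⟨hx, h.right, ?_, ?_, h.zy, h.uy⟩ <;> rw [hv] <;>
    simp only [mul_add, add_mul, smul_mul_assoc, mul_smul_comm, h.rules, mul_one, one_mul]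
  have h₂ : BiquaternionRel α₁ β γ δ₁ (e⁻¹ • (y * v)) y z (p • u + r • (z * u)) := by
    have comm : ∀ w : A, z * w = w * z → u * w = w * u →
        (p • u + r • (z * u)) * w = w * (p • u + r • (z * u)) := fun w hz hu => by
      simp only [add_mul, mul_add, smul_mul_assoc, mul_smul_comm, mul_assoc, hu, commute_rules hz]
    exact ⟨hx, hu, h₁.zx, comm _ h₁.zx h₁.ux, h.zy, comm _ h.zy h.uy⟩
  -- The parameter supplies the missing term: `e⁻¹ y v` becomes `e⁻¹ y y'`.
  have h₃ := h₂.omegaI (e⁻¹ * a)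
  have s₁ : Lambda1 (h.toQuadruple hd) (h₁.toQuadruple hd) := Or.inl ⟨rfl, rfl, rfl⟩
  have s₂ : Lambda1 (h₁.toQuadruple hd) (h₂.toQuadruple hd) :=
    Or.inr (Or.inr (Or.inr ⟨rfl, rfl, rfl⟩))
  have s₃ : Omega (h₂.toQuadruple hd) (h₃.toQuadruple hd) := Or.inl ⟨_, rfl, rfl, rfl, rfl⟩
  have t₁ : Lambda1 (h₁.toQuadruple hd) (h.toQuadruple hd) := Or.inl ⟨rfl, rfl, rfl⟩
  have t₂ : Lambda1 (h₂.toQuadruple hd) (h₁.toQuadruple hd) :=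
    Or.inr (Or.inr (Or.inr ⟨rfl, rfl, rfl⟩))
  -- In characteristic 2 a step Ω_i is its own inverse.
  have cancel : ∀ w w' : A, w = w + w' + w' := fun w w' => by
    rw [add_assoc, add_self_of_charTwo F, add_zero]
  have t₃ : Omega (h₃.toQuadruple hd) (h₂.toQuadruple hd) :=
    Or.inl ⟨_, rfl, rfl, cancel _ _, cancel _ _⟩
  refine ⟨h₃.toQuadruple hd, ?_, rfl, (s₁.connected.trans s₂.connected).trans s₃.connected,
    (t₃.connected.trans t₂.connected).trans t₁.connected⟩
  change e⁻¹ • (y * v) + (e⁻¹ * a) • (y * (p • u + r • (z * u))) = _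
  rw [mul_smul, ← mul_smul_comm a, ha, ← smul_add, ← mul_add, hy', hv]
  simp only [add_assoc]

/-- Both ends reach, in three steps, a quadruple with the factor generated by `y` and `y'`; eight Λ₁
steps join these. -/
theorem GenQuadruple.connected_of_commutator (hd : Module.finrank F A = 16)
    (q q' : GenQuadruple F A) (hs : IsCanonicalInvolution s q.x q.y q.z q.u)
    (hs' : IsCanonicalInvolution s q'.x q'.y q'.z q'.u) {e : F} (he : e ≠ 0)
    (hyy : q.y * q'.y + q'.y * q.y = e • 1) :
    ConnectedByChain 14 2 q.toUnordered q'.toUnordered := by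
  obtain ⟨α, β, γ, δ, h⟩ := q.exists_rel
  obtain ⟨α', β', γ', δ', h'⟩ := q'.exists_rel
  obtain ⟨c₀, c₂, c₃, d₂, d₃, e₁⟩ := hs.exists_y_eq hs' h h' hd
  obtain ⟨c₀', c₂', c₃', d₂', d₃', e₂⟩ := hs'.exists_y_eq hs h' h hd
  obtain ⟨p, hpx, hpy, hp, -⟩ := h.exists_omegaI hd he e₁ hyy
  obtain ⟨p', hpx', hpy', -, hp'⟩ := h'.exists_omegaI hd he e₂ (by rw [add_comm, hyy])
  obtain ⟨_, _, _, _, hh⟩ := p.exists_rel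
  have key : ∀ w : A, w * p.x = p.x * w → w * p.y = p.y * w → w * q'.y = q'.y * w := by
    intro w hx hy
    rw [hpx, mul_smul_comm, smul_mul_assoc] at hx
    have hx' := smul_right_injective A (inv_ne_zero he) hx
    rw [hpy] at hy
    refine mul_left_cancel₀ h.left.y_ne_zero ?_
    rw [← mul_assoc, ← hy, mul_assoc, ← mul_assoc q.y]
    exact hx'
  have key' : ∀ w : A, w * p.x = p.x * w → w * p.y = p.y * w → w * p'.x = p'.x * w := by
    intro w hx hy
    rw [hpx', mul_smul_comm, smul_mul_assoc, ← mul_assoc, key w hx hy, mul_assoc, ← hpy, hy,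
      mul_assoc]
  have mid := GenQuadruple.connected_of_commute hd p p' (key' _ hh.zx hh.zy) (key' _ hh.ux hh.uy)
    (by rw [hpy']; exact key _ hh.zx hh.zy) (by rw [hpy']; exact key _ hh.ux hh.uy)
  exact (hp.trans mid).trans hp'

/-- The polar value of `y'` with `y` is `c₃ β`; if it vanishes, one Λ₁ step replaces `y` by `x y`,
giving `c₂ β`. -/
theorem GenQuadruple.connected_of_eq_add (hd : Module.finrank F A = 16)
    (q q' : GenQuadruple F A) (hs : IsCanonicalInvolution s q.x q.y q.z q.u)
    (hs' : IsCanonicalInvolution s q'.x q'.y q'.z q'.u) {c₀ c₂ c₃ d₂ d₃ : F}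
    (e : q'.y = c₀ • 1 + c₂ • q.y + c₃ • (q.x * q.y) + d₂ • q.u + d₃ • (q.z * q.u))
    (hc : c₂ ≠ 0 ∨ c₃ ≠ 0) : ConnectedByChain 15 2 q.toUnordered q'.toUnordered := by
  obtain ⟨α, β, γ, δ, h⟩ := q.exists_rel
  by_cases hc₃ : c₃ = 0
  · have hc₂ := hc.resolve_right (not_not.2 hc₃)
    have hm : BiquaternionRel α (α * β) γ δ q.x (q.x * q.y) q.z q.u :=
      ⟨h.left.mul_right, h.right, h.zx, h.ux,
        by rw [← mul_assoc, h.zx, mul_assoc, h.zy, mul_assoc],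
        by rw [← mul_assoc, h.ux, mul_assoc, h.uy, mul_assoc]⟩
    have s1 : Lambda1 q (hm.toQuadruple hd) := Or.inr (Or.inl ⟨rfl, rfl, rfl⟩)
    have hsm : IsCanonicalInvolution s q.x (q.x * q.y) q.z q.u := by
      refine ⟨hs.map_mul, hs.map_one, hs.map_x, ?_, hs.map_z, hs.map_u⟩
      rw [hs.map_mul, hs.map_x, hs.map_y, mul_add, mul_one, h.left.yx, add_assoc,
        add_self_of_charTwo F, add_zero]
    refine (s1.connected.trans (GenQuadruple.connected_of_commutator (e := c₂ * β) hd
      (hm.toQuadruple hd) q' hsm hs' (mul_ne_zero hc₂ h.left.ne_zero) ?_)).mono (by norm_num)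
      (by norm_num)
    rw [e, hc₃]
    simp only [BiquaternionRel.toQuadruple, mul_add, add_mul, mul_assoc, smul_mul_assoc,
      mul_smul_comm, h.rules, mul_one, one_mul, smul_add]
    match_scalars <;> grind
  · refine (GenQuadruple.connected_of_commutator (e := c₃ * β) hd q q' hs hs'
      (mul_ne_zero hc₃ h.left.ne_zero) ?_).mono (by norm_num) le_rfl
    rw [e]
    simp only [mul_add, add_mul, mul_assoc, smul_mul_assoc, mul_smul_comm, h.rules, mul_one,
      one_mul, smul_add]
    match_scalars <;> grind

/-- Quadruples with the same canonical involution are connected by a chain with at most two steps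
of type `Ω_i`. -/
theorem GenQuadruple.connected_of_involution_eq (hd : Module.finrank F A = 16)
    (q q' : GenQuadruple F A) (hs : IsCanonicalInvolution s q.x q.y q.z q.u)
    (hs' : IsCanonicalInvolution s q'.x q'.y q'.z q'.u) :
    ConnectedByChain 15 2 q.toUnordered q'.toUnordered := by
  obtain ⟨α, β, γ, δ, h⟩ := q.exists_rel
  obtain ⟨α', β', γ', δ', h'⟩ := q'.exists_rel
  obtain ⟨c₀, c₂, c₃, d₂, d₃, e⟩ := hs.exists_y_eq hs' h h' hd
  by_cases hc : c₂ ≠ 0 ∨ c₃ ≠ 0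
  · exact GenQuadruple.connected_of_eq_add hd q q' hs hs' e hc
  · push Not at hc
    have e' : q'.y = c₀ • 1 + d₂ • q.u + d₃ • (q.z * q.u) + c₂ • q.y + c₃ • (q.x * q.y) := by
      rw [e]
      abel
    -- Without first-factor terms, `y'` must involve the second factor, being no scalar; the pairs
    -- are interchanged.
    have := GenQuadruple.connected_of_eq_add hd q.swap q' hs.swap hs' e' (by
      by_contra! H
      refine h'.left.y_not_scalar c₀ ?_
      rw [e, hc.1, hc.2, H.1, H.2]
      simp)
    rwa [toUnordered_swap] at this

end SameInvolution

/-! ### Assembly of the two halves. -/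

theorem mainTheorem4 {F A : Type*} [Field F] [CharP F 2] [DivisionRing A] [Algebra F A]
    (hA : IsBiquaternionAlgebra F A) (q q' : GenQuadruple F A) :
    GenQuadruple.ConnectedByChain 45 6 q.toUnordered q'.toUnordered := by
  have hd := hA.finrank_eq
  obtain ⟨α, β, γ, δ, h⟩ := q'.exists_rel
  obtain ⟨s, hs⟩ := h.exists_involution hd
  obtain ⟨q₂, h₂, hs₂⟩ := GenQuadruple.exists_connected_of_involution hd q q' hs
  exact (h₂.trans (GenQuadruple.connected_of_involution_eq hd q₂ q' hs₂ hs)).mono (by norm_num)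
    (by norm_num)
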